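/- Let $\mathbb D\subset\mathbb C$ be the open unit disk, $\mathbb S=\partial\mathbb D$, and let $\varphi:\mathbb S\to\mathbb S$ be a homeomorphism onto $\mathbb S$. Let $h:\overline{\mathbb D}\to\mathbb C$ be the harmonic extension of $\varphi$, i.e. $h=\varphi$ on $\mathbb S$ and $$h(z)=\frac1{2\pi}\int_0^{2\pi}\frac{1-|z|^2}{|e^{i\theta}-z|^2}\,\varphi(e^{i\theta})\,d\theta\qquad(z\in\mathbb D).$$ Then $h$ is harmonic in $\mathbb D$ and is a homeomorphism of $\overline{\mathbb D}$ onto $\overline{\mathbb D}$ with $h|_{\mathbb S}=\varphi$, and for every $p\in(1,\infty)$ the homeomorphism $h$ belongs to the Sobolev space $W^{1,p}(\mathbb D,\mathbb C)$ (that is, $h$ and its weak differential are in $L^p(\mathbb D)$) if and only if $\varphi$ satisfies the $p$-Douglas condition $$\int_{\mathbb S}\int_{\mathbb S}\left|\frac{\varphi(\xi)-\varphi(\eta)}{\xi-\eta}\right|^p\,|d\xi|\,|d\eta|<\infty .$$ -/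

import Mathlib

open MeasureTheory

/-- The Poisson integral at the point `z` of the open unit disk of a circle map `φ`:
`(2π)⁻¹ ∫_0^{2π} (1 - |z|²) / |e^{iθ} - z|² φ(e^{iθ}) dθ`. -/
noncomputable def poissonIntegral (φ : Circle → Circle) (z : ℂ) : ℂ :=
  (2 * Real.pi)⁻¹ •
    ∫ θ in (0 : ℝ)..(2 * Real.pi), poissonKernel 0 z (Circle.exp θ) • (φ (Circle.exp θ) : ℂ)

open Classical in
/-- The harmonic extension of a circle map `φ` to the closed unit disk: `φ` itself on the unit
circle and the Poisson integral of `φ` inside. (Values outside the closed disk are irrelevant.) -/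
noncomputable def harmonicExtension (φ : Circle → Circle) (z : ℂ) : ℂ :=
  if hz : ‖z‖ = 1 then (φ ⟨z, mem_sphere_zero_iff_norm.2 hz⟩ : ℂ) else poissonIntegral φ z

/-- `g` is a weak (distributional) real differential of `f` on the open set `Ω ⊆ ℂ`:
for every real test function `ψ ∈ C_c^∞(Ω)` and every direction `v`,
`∫_Ω (∂_v ψ) f = - ∫_Ω ψ g(·) v`. -/
def HasWeakFDerivOn (f : ℂ → ℂ) (g : ℂ → ℂ →L[ℝ] ℂ) (Ω : Set ℂ) : Prop :=
  ∀ ψ : ℂ → ℝ, ContDiff ℝ (⊤ : ℕ∞) ψ → HasCompactSupport ψ → tsupport ψ ⊆ Ω →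
    ∀ v : ℂ, ∫ z in Ω, fderiv ℝ ψ z v • f z = - ∫ z in Ω, ψ z • g z v

/-- Membership in the Sobolev space `W^{1,p}(Ω, ℂ)`, `Ω ⊆ ℂ` open, with respect to planar
Lebesgue measure: `f ∈ L^p(Ω)` and `f` has a weak differential in `L^p(Ω)`. -/
def MemW1p (p : ENNReal) (f : ℂ → ℂ) (Ω : Set ℂ) : Prop :=
  MemLp f p (volume.restrict Ω) ∧
    ∃ g : ℂ → ℂ →L[ℝ] ℂ, MemLp g p (volume.restrict Ω) ∧ HasWeakFDerivOn f g Ω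

/-- The `p`-Douglas condition
`∫_𝕊 ∫_𝕊 |(φ(ξ) - φ(η)) / (ξ - η)|^p |dξ| |dη| < ∞`,
the circle being parametrized by arc length. -/
def DouglasCondition (p : ℝ) (φ : Circle → Circle) : Prop :=
  ∫⁻ s in Set.Ioc (0 : ℝ) (2 * Real.pi), ∫⁻ t in Set.Ioc (0 : ℝ) (2 * Real.pi),
    ENNReal.ofReal
      (‖((φ (Circle.exp s) : ℂ) - φ (Circle.exp t)) / ((Circle.exp s : ℂ) - Circle.exp t)‖ ^ p)
    < ⊤

open InnerProductSpace Metric Set Filter Topology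

/-! Harmonicity and boundary continuity are classical: a real Poisson integral is the real part of a
holomorphic Herglotz–Riesz integral, and the Poisson kernel is an approximate identity.

The homeomorphism statement is the Radó–Kneser–Choquet theorem, proved here without Jacobians.
Suppose two interior points have the same image `w`. A Möbius map of the disk and a rotation move
them to `0` and `r ∈ (0, 1)`. A winding argument gives a chord through `w` whose end points have
parameters `e^{is}` and `e^{-is}`. A real linear functional vanishing along the chord then changes
sign on the circle at most at `e^{±is}`, and it has zero average both against arc length and against
the Poisson kernel of `r`. That kernel is a decreasing function of `cos t`, hence larger than its
value at `e^{is}` on one arc and smaller on the other. So some combination of the two weights makes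
the integrand positive off two points, a contradiction (`apply_zero_ne_apply_ofReal`). Surjectivity
follows from winding numbers (`surjOn_ball_of_harmonicContOnCl`).

For the Sobolev statement, uniqueness of weak derivatives and boundedness of `h` reduce membership
in `W^{1,p}` to `∫ ‖dh‖^p < ∞`, and the Douglas integral is twice the integral over `τ ∈ (0, π)` of
an arc energy. Both directions rest on the Hardy–Hilbert inequality for the kernel `1 / max x y`
(`exists_lintegral_inv_max_le`), obtained from Schur's test. From Douglas to Sobolev, the gradient
at depth `ε` below the boundary is at most a constant times `∫ max(ε, τ)⁻¹ D(θ, τ) dτ`, with `D` the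
symmetric difference quotient of `φ`. Conversely, two boundary points at arc distance `τ` are joined
by going radially to depth `τ`, along an arc, and back out; the radial legs are controlled by the
same inequality and the arc by averaging. -/

/-! ### Poisson integrals: harmonicity and boundary values. -/

theorem circleMap_zero_one_eq_circleExp (θ : ℝ) : circleMap 0 1 θ = Circle.exp θ := by
  simp [circleMap]

theorem circleAverage_zero_one_eq (f : ℂ → ℂ) :
    Real.circleAverage f 0 1 =
      (2 * Real.pi)⁻¹ • ∫ θ in (0 : ℝ)..(2 * Real.pi), f (Circle.exp θ) := by
  simp_rw [Real.circleAverage_def, circleMap_zero_one_eq_circleExp]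

theorem circleIntegrable_of_continuousOn {E : Type*} [NormedAddCommGroup E] {f : ℂ → E}
    (hf : ContinuousOn f (sphere 0 1)) : CircleIntegrable f 0 1 :=
  hf.circleIntegrable zero_le_one

theorem harmonicExtension_coe (φ : Circle → Circle) (ξ : Circle) :
    harmonicExtension φ ξ = φ ξ :=
  dif_pos ξ.norm_coe

theorem harmonicExtension_eq_circleAverage (φ : Circle → Circle) {z : ℂ} (hz : ‖z‖ < 1) :
    harmonicExtension φ z =
      Real.circleAverage (poissonKernel 0 z • harmonicExtension φ) 0 1 := by
  rw [circleAverage_zero_one_eq, harmonicExtension, dif_neg hz.ne, poissonIntegral]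
  simp_rw [Pi.smul_apply', harmonicExtension_coe]

theorem continuousOn_sphere_iff_comp_coe {E : Type*} [TopologicalSpace E] {f : ℂ → E} :
    ContinuousOn f (sphere 0 1) ↔ Continuous fun ξ : Circle ↦ f ξ :=
  continuousOn_iff_continuous_domRestrict

theorem continuousOn_harmonicExtension_sphere {φ : Circle → Circle} (hφ : Continuous φ) :
    ContinuousOn (harmonicExtension φ) (sphere 0 1) := by
  rw [continuousOn_sphere_iff_comp_coe]
  simp_rw [harmonicExtension_coe]
  fun_prop

theorem continuousOn_poissonKernel_sphere {z : ℂ} (hz : z ∈ ball (0 : ℂ) 1) :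
    ContinuousOn (poissonKernel 0 z) (sphere 0 1) := by
  rw [poissonKernel_eq_re_herglotzRieszKernel]
  have := continuousOn_herglotzRieszKernel_sphere hz
  rw [abs_one] at this
  exact Complex.continuous_re.comp_continuousOn this

theorem poissonKernel_pos {z ζ : ℂ} (hz : z ∈ ball (0 : ℂ) 1) (hζ : ζ ∈ sphere (0 : ℂ) 1) :
    0 < poissonKernel 0 z ζ := by
  simp only [mem_ball_zero_iff, mem_sphere_zero_iff_norm] at hz hζ
  rw [poissonKernel_def]
  have : ζ - z ≠ 0 := by rintro h; rw [sub_eq_zero] at h; subst h; linarith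
  simp only [sub_zero, hζ]
  have := norm_nonneg z
  apply div_pos
  · nlinarith
  · positivity

theorem circleAverage_poissonKernel {z : ℂ} (hz : z ∈ ball (0 : ℂ) 1) :
    Real.circleAverage (poissonKernel 0 z) 0 1 = 1 := by
  have := HarmonicContOnCl.circleAverage_poissonKernel_smul
    (harmonicContOnCl_const (c := (1 : ℝ)) (s := ball (0 : ℂ) 1)) hz
  rw [← this]
  congr 1
  ext; simp

theorem circleAverage_poissonKernel_smul_eq_re {g : ℂ → ℝ} (hg : ContinuousOn g (sphere 0 1))
    {z : ℂ} (hz : z ∈ ball (0 : ℂ) 1) :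
    Real.circleAverage (poissonKernel 0 z • g) 0 1 =
      (Real.circleAverage (fun ζ ↦ herglotzRieszKernel 0 z ζ • (g ζ : ℂ)) 0 1).re := by
  rw [re_circleAverage_herglotzRieszKernel_smul (circleIntegrable_of_continuousOn hg) hz,
    poissonKernel_eq_re_herglotzRieszKernel]

/-- The Herglotz–Riesz integral is holomorphic in `z`, and the Poisson integral of a real function
is its real part. -/
theorem harmonicOnNhd_circleAverage_poissonKernel_smul_real {g : ℂ → ℝ}
    (hg : ContinuousOn g (sphere 0 1)) :
    HarmonicOnNhd (fun z ↦ Real.circleAverage (poissonKernel 0 z • g) 0 1) (ball (0 : ℂ) 1) := by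
  intro z hz
  have h1 : CircleIntegrable (fun ζ ↦ (g ζ : ℂ)) 0 1 :=
    circleIntegrable_of_continuousOn (Complex.continuous_ofReal.comp_continuousOn hg)
  have h2 := (analyticOnNhd_circleAverage_herglotzRieszKernel_smul h1 z hz).harmonicAt_re
  refine (harmonicAt_congr_nhds ?_).2 h2
  filter_upwards [isOpen_ball.mem_nhds hz] with w hw
  exact circleAverage_poissonKernel_smul_eq_re hg hw

theorem harmonicOnNhd_of_re_im {f : ℂ → ℂ} {s : Set ℂ}
    (hre : HarmonicOnNhd (fun z ↦ (f z).re) s) (him : HarmonicOnNhd (fun z ↦ (f z).im) s) :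
    HarmonicOnNhd f s := by
  have h := (hre.comp_CLM Complex.ofRealCLM).add
    (him.comp_CLM ((ContinuousLinearMap.mul ℝ ℂ Complex.I).comp Complex.ofRealCLM))
  convert h using 1
  ext z
  simp [mul_comm Complex.I]

theorem circleAverage_smul_re {k : ℂ → ℝ} {g : ℂ → ℂ}
    (hk : ContinuousOn k (sphere 0 1)) (hg : ContinuousOn g (sphere 0 1)) (L : ℂ →L[ℝ] ℝ) :
    L (Real.circleAverage (k • g) 0 1) = Real.circleAverage (k • (fun ζ ↦ L (g ζ))) 0 1 := by
  rw [← L.circleAverage_comp_comm (circleIntegrable_of_continuousOn (hk.smul hg))]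
  congr 1
  ext ζ
  exact L.map_smul (k ζ) (g ζ)

theorem circleAverage_poissonKernel_smul_eq {f : ℂ → ℂ} (hf : HarmonicContOnCl f (ball 0 1))
    {z : ℂ} (hz : z ∈ ball (0 : ℂ) 1) :
    Real.circleAverage (poissonKernel 0 z • f) 0 1 = f z := by
  have key (L : ℂ →L[ℝ] ℝ) : L (Real.circleAverage (poissonKernel 0 z • f) 0 1) = L (f z) := by
    rw [circleAverage_smul_re (continuousOn_poissonKernel_sphere hz)
      (hf.continuousOn_ball.mono sphere_subset_closedBall)]
    exact HarmonicContOnCl.circleAverage_poissonKernel_smul (hf.comp_CLM L) hz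
  exact Complex.ext (key Complex.reCLM) (key Complex.imCLM)

theorem harmonicOnNhd_circleAverage_poissonKernel_smul {g : ℂ → ℂ}
    (hg : ContinuousOn g (sphere 0 1)) :
    HarmonicOnNhd (fun z ↦ Real.circleAverage (poissonKernel 0 z • g) 0 1) (ball (0 : ℂ) 1) := by
  have key (L : ℂ →L[ℝ] ℝ) : HarmonicOnNhd
      (fun z ↦ L (Real.circleAverage (poissonKernel 0 z • g) 0 1)) (ball (0 : ℂ) 1) := by
    intro z hz
    refine (harmonicAt_congr_nhds ?_).2 (harmonicOnNhd_circleAverage_poissonKernel_smul_real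
      (L.continuous.comp_continuousOn hg) z hz)
    filter_upwards [isOpen_ball.mem_nhds hz] with w hw
    exact circleAverage_smul_re (continuousOn_poissonKernel_sphere hw) hg L
  exact harmonicOnNhd_of_re_im (key Complex.reCLM) (key Complex.imCLM)

theorem harmonicOnNhd_harmonicExtension {φ : Circle → Circle} (hφ : Continuous φ) :
    HarmonicOnNhd (harmonicExtension φ) (ball 0 1) := by
  intro z hz
  refine (harmonicAt_congr_nhds ?_).2 (harmonicOnNhd_circleAverage_poissonKernel_smul
    (continuousOn_harmonicExtension_sphere hφ) z hz)
  filter_upwards [isOpen_ball.mem_nhds hz] with w hw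
  exact harmonicExtension_eq_circleAverage φ (by simpa using hw)

theorem norm_circleAverage_le_circleAverage_norm (f : ℂ → ℂ) :
    ‖Real.circleAverage f 0 1‖ ≤ Real.circleAverage (fun ζ ↦ ‖f ζ‖) 0 1 := by
  rw [Real.circleAverage_def, Real.circleAverage_def, norm_smul, smul_eq_mul, Real.norm_eq_abs,
    abs_of_pos (by positivity)]
  gcongr
  exact intervalIntegral.norm_integral_le_integral_norm (by positivity)

/-- The kernel is positive with mean `1`, and away from `ζ₀` it tends uniformly to `0` as `z → ζ₀`.
-/
theorem tendsto_circleAverage_poissonKernel_smul {g : ℂ → ℂ}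
    (hg : ContinuousOn g (sphere 0 1)) {ζ₀ : ℂ} (hζ₀ : ζ₀ ∈ sphere (0 : ℂ) 1) :
    Tendsto (fun z ↦ Real.circleAverage (poissonKernel 0 z • g) 0 1) (𝓝[ball 0 1] ζ₀)
      (𝓝 (g ζ₀)) := by
  obtain ⟨M, hM⟩ := (isCompact_sphere (0 : ℂ) 1).exists_bound_of_continuousOn hg
  have hM0 : 0 ≤ M := (norm_nonneg _).trans (hM ζ₀ hζ₀)
  rw [Metric.tendsto_nhdsWithin_nhds]
  intro ε hε
  obtain ⟨δ, hδ, hgδ⟩ := Metric.continuousOn_iff.1 hg ζ₀ hζ₀ (ε / 2) (by positivity)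
  -- Bound for the far part: there `‖ζ - z‖ ≥ δ / 2`, so the kernel is at most `4 (1 - ‖z‖²) / δ²`,
  -- while the oscillation of `g` is at most `2 M`.
  have hnorm : Tendsto (fun z : ℂ ↦ 8 * M / δ ^ 2 * (1 - ‖z‖ ^ 2)) (𝓝 ζ₀) (𝓝 0) := by
    have : Continuous (fun z : ℂ ↦ 8 * M / δ ^ 2 * (1 - ‖z‖ ^ 2)) := by fun_prop
    have h := this.tendsto ζ₀
    simpa [mem_sphere_zero_iff_norm.1 hζ₀] using h
  obtain ⟨δ', hδ', hz'⟩ := Metric.tendsto_nhds_nhds.1 hnorm (ε / 2) (by positivity)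
  refine ⟨min (δ / 2) δ', by positivity, fun {z} hz hzζ ↦ ?_⟩
  have hz1 : ‖z‖ < 1 := by simpa using hz
  have hPc := continuousOn_poissonKernel_sphere hz
  have h1 : Real.circleAverage (poissonKernel 0 z • g) 0 1 - g ζ₀ =
      Real.circleAverage (poissonKernel 0 z • (fun ζ ↦ g ζ - g ζ₀)) 0 1 := by
    have e : poissonKernel 0 z • (fun ζ ↦ g ζ - g ζ₀) =
        poissonKernel 0 z • g - poissonKernel 0 z • (fun _ ↦ g ζ₀) := by
      ext ζ; simp [mul_sub]
    rw [e, Real.circleAverage_sub (circleIntegrable_of_continuousOn (hPc.smul hg))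
      (circleIntegrable_of_continuousOn (hPc.smul continuousOn_const)),
      circleAverage_poissonKernel_smul_eq harmonicContOnCl_const hz]
  have hb : ∀ ζ ∈ sphere (0 : ℂ) |1|, ‖(poissonKernel 0 z • (fun ζ ↦ g ζ - g ζ₀)) ζ‖ ≤
      ε / 2 * poissonKernel 0 z ζ + 8 * M / δ ^ 2 * (1 - ‖z‖ ^ 2) := by
    intro ζ hζ
    rw [abs_one] at hζ
    have hP := poissonKernel_pos hz hζ
    have hζ1 : ‖ζ‖ = 1 := by simpa using hζ
    have hpos : 0 ≤ 8 * M / δ ^ 2 * (1 - ‖z‖ ^ 2) := by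
      have : ‖z‖ ^ 2 ≤ 1 := by nlinarith [norm_nonneg z]
      have : 0 ≤ 1 - ‖z‖ ^ 2 := by linarith
      positivity
    simp only [Pi.smul_apply', norm_smul, Real.norm_eq_abs, abs_of_pos hP]
    by_cases hd : dist ζ ζ₀ < δ
    · have := hgδ ζ hζ hd
      rw [dist_eq_norm] at this
      nlinarith
    · have hdz : δ / 2 ≤ ‖ζ - z‖ := by
        have := dist_triangle ζ z ζ₀
        have h3 := hzζ.trans_le (min_le_left _ _)
        rw [← dist_eq_norm]
        linarith
      have hPle : poissonKernel 0 z ζ ≤ 4 / δ ^ 2 * (1 - ‖z‖ ^ 2) := by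
        rw [poissonKernel_def]
        simp only [sub_zero, hζ1, one_pow]
        have h4 : 0 ≤ 1 - ‖z‖ ^ 2 := by nlinarith [norm_nonneg z]
        calc (1 - ‖z‖ ^ 2) / ‖ζ - z‖ ^ 2 ≤ (1 - ‖z‖ ^ 2) / (δ / 2) ^ 2 := by gcongr
          _ = _ := by field_simp; ring
      have hn : ‖g ζ - g ζ₀‖ ≤ 2 * M := by
        have := norm_sub_le (g ζ) (g ζ₀)
        linarith [hM ζ hζ, hM ζ₀ hζ₀]
      calc poissonKernel 0 z ζ * ‖g ζ - g ζ₀‖ ≤ (4 / δ ^ 2 * (1 - ‖z‖ ^ 2)) * (2 * M) := by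
            gcongr
            exact hP.le.trans hPle
        _ = 8 * M / δ ^ 2 * (1 - ‖z‖ ^ 2) := by ring
        _ ≤ _ := by nlinarith
  rw [dist_eq_norm, h1]
  refine (norm_circleAverage_le_circleAverage_norm _).trans_lt ?_
  have hgc : ContinuousOn (fun ζ ↦ g ζ - g ζ₀) (sphere 0 1) := hg.sub continuousOn_const
  have h5 := Real.circleAverage_mono
    (circleIntegrable_of_continuousOn (hPc.smul hgc).norm)
    (circleIntegrable_of_continuousOn
      ((hPc.const_mul (ε / 2)).add (continuousOn_const (c := 8 * M / δ ^ 2 * (1 - ‖z‖ ^ 2))))) hb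
  refine h5.trans_lt ?_
  have h6 : Real.circleAverage
      (fun ζ ↦ ε / 2 * poissonKernel 0 z ζ + 8 * M / δ ^ 2 * (1 - ‖z‖ ^ 2)) 0 1 =
      ε / 2 + 8 * M / δ ^ 2 * (1 - ‖z‖ ^ 2) := by
    have e : (fun ζ ↦ ε / 2 * poissonKernel 0 z ζ + 8 * M / δ ^ 2 * (1 - ‖z‖ ^ 2)) =
      (ε / 2) • poissonKernel 0 z + fun _ ↦ 8 * M / δ ^ 2 * (1 - ‖z‖ ^ 2) := by ext; simp
    rw [e, Real.circleAverage_add (circleIntegrable_of_continuousOn (hPc.const_smul _))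
      (circleIntegrable_of_continuousOn continuousOn_const), Real.circleAverage_smul,
      Real.circleAverage_const, circleAverage_poissonKernel hz]
    simp
  have h7 := hz' (hzζ.trans_le (min_le_right _ _))
  rw [Real.dist_0_eq_abs] at h7
  have := le_abs_self (8 * M / δ ^ 2 * (1 - ‖z‖ ^ 2))
  calc _ = _ := h6
    _ < ε := by linarith

theorem harmonicContOnCl_harmonicExtension {φ : Circle → Circle} (hφ : Continuous φ) :
    HarmonicContOnCl (harmonicExtension φ) (ball 0 1) := by
  have hH := harmonicOnNhd_harmonicExtension hφ
  have hS := continuousOn_harmonicExtension_sphere hφ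
  refine .mk_ball hH fun z hz ↦ ?_
  rw [← ball_union_sphere] at hz ⊢
  rcases hz with hz | hz
  · exact (hH.continuousOn.continuousAt (isOpen_ball.mem_nhds hz)).continuousWithinAt
  · refine ContinuousWithinAt.union ?_ (hS z hz)
    refine (tendsto_circleAverage_poissonKernel_smul hS hz).congr' ?_
    filter_upwards [self_mem_nhdsWithin] with w hw
    exact (harmonicExtension_eq_circleAverage φ (by simpa using hw)).symm

/-! ### The Radó–Kneser–Choquet theorem: chords and signs. -/

theorem circleAverage_pos {g : ℂ → ℝ} (hg : ContinuousOn g (sphere 0 1))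
    (h0 : ∀ ζ ∈ sphere (0 : ℂ) 1, 0 ≤ g ζ) {ζ₀ : ℂ} (hζ₀ : ζ₀ ∈ sphere (0 : ℂ) 1)
    (hpos : 0 < g ζ₀) : 0 < Real.circleAverage g 0 1 := by
  rw [Real.circleAverage_def]
  simp_rw [circleMap_zero_one_eq_circleExp]
  have hc : Continuous fun θ : ℝ ↦ g (Circle.exp θ) :=
    (continuousOn_sphere_iff_comp_coe.1 hg).comp Circle.exp.continuous
  refine smul_pos (by positivity) (intervalIntegral.integral_pos (by positivity) hc.continuousOn
    (fun θ _ ↦ h0 _ (Circle.exp θ).2) ?_)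
  obtain ⟨t, ht⟩ : ∃ t : ℝ, Circle.exp t = (⟨ζ₀, hζ₀⟩ : Circle) := ⟨_, Circle.exp_arg _⟩
  refine ⟨toIcoMod Real.two_pi_pos 0 t, ?_, ?_⟩
  · have := toIcoMod_mem_Ico Real.two_pi_pos 0 t
    rw [zero_add] at this
    exact Ico_subset_Icc_self this
  · have : Circle.exp (toIcoMod Real.two_pi_pos 0 t) = Circle.exp t := by
      rw [toIcoMod, Circle.periodic_exp.sub_zsmul_eq]
    rw [this, ht]
    exact hpos

theorem circleAverage_poissonKernel_smul_clm {F : ℂ → ℂ} (hF : HarmonicContOnCl F (ball 0 1))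
    (L : ℂ →L[ℝ] ℝ) (w : ℂ) {z : ℂ} (hz : z ∈ ball (0 : ℂ) 1) :
    Real.circleAverage (fun ζ ↦ poissonKernel 0 z ζ * L (F ζ - w)) 0 1 = L (F z - w) :=
  HarmonicContOnCl.circleAverage_poissonKernel_smul ((hF.fun_sub_const w).comp_CLM L) hz

theorem circleAverage_clm {F : ℂ → ℂ} (hF : HarmonicContOnCl F (ball 0 1))
    (L : ℂ →L[ℝ] ℝ) (w : ℂ) :
    Real.circleAverage (fun ζ ↦ L (F ζ - w)) 0 1 = L (F 0 - w) := by
  have := InnerProductSpace.HarmonicContOnCl.circleAverage_eq (c := (0 : ℂ)) (R := 1)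
    (f := fun ζ ↦ L (F ζ - w)) (by rw [abs_one]; exact (hF.fun_sub_const w).comp_CLM L)
  exact this

/-- The real-linear functional `x ↦ Re (c̄ x)`. -/
noncomputable def reConjMul (c : ℂ) : ℂ →L[ℝ] ℝ :=
  Complex.reCLM.comp (ContinuousLinearMap.mul ℝ ℂ (starRingEnd ℂ c))

/-- The real-linear functional `x ↦ Im (c̄ x)`. -/
noncomputable def imConjMul (c : ℂ) : ℂ →L[ℝ] ℝ :=
  Complex.imCLM.comp (ContinuousLinearMap.mul ℝ ℂ (starRingEnd ℂ c))

theorem reConjMul_apply (c x : ℂ) : reConjMul c x = c.re * x.re + c.im * x.im := by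
  simp [reConjMul]

theorem imConjMul_apply (c x : ℂ) : imConjMul c x = c.re * x.im - c.im * x.re := by
  simp [imConjMul]; ring

theorem norm_sq_eq_re_im (x : ℂ) : ‖x‖ ^ 2 = x.re * x.re + x.im * x.im := by
  rw [← Complex.normSq_eq_norm_sq, Complex.normSq_apply]

/-- Strict convexity of the disk: a value outside the open disk cannot be a weighted mean, with
positive weight, of a nonconstant function into the circle. -/
theorem mapsTo_ball_of_harmonicContOnCl {F : ℂ → ℂ} (hF : HarmonicContOnCl F (ball 0 1))
    (hmap : MapsTo F (sphere 0 1) (sphere 0 1)) (hinj : InjOn F (sphere 0 1)) :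
    MapsTo F (ball 0 1) (ball 0 1) := by
  intro z hz
  by_contra hc
  have hc1 : 1 ≤ ‖F z‖ := by simpa using hc
  set c := F z with hcdef
  have havg := circleAverage_poissonKernel_smul_clm hF (-reConjMul c) c hz
  rw [← hcdef, sub_self, map_zero] at havg
  -- Polarization with `‖F ζ‖ = 1`. The right side is nonnegative, and positive wherever `F ζ ≠ c`.
  have hval : ∀ ζ ∈ sphere (0 : ℂ) 1,
      (-reConjMul c) (F ζ - c) = ((‖c‖ ^ 2 - 1) + ‖F ζ - c‖ ^ 2) / 2 := by
    intro ζ hζ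
    have h1 : ‖F ζ‖ ^ 2 = 1 := by
      rw [mem_sphere_zero_iff_norm.1 (hmap hζ), one_pow]
    rw [norm_sq_eq_re_im] at h1 ⊢
    rw [norm_sq_eq_re_im]
    simp only [neg_apply, reConjMul_apply, Complex.sub_re, Complex.sub_im]
    nlinarith
  have hcont : ContinuousOn (fun ζ ↦ poissonKernel 0 z ζ * (-reConjMul c) (F ζ - c))
      (sphere 0 1) :=
    (continuousOn_poissonKernel_sphere hz).mul ((-reConjMul c).continuous.comp_continuousOn
      ((hF.continuousOn_ball.mono sphere_subset_closedBall).sub continuousOn_const))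
  obtain ⟨ζ₀, hζ₀, hne⟩ : ∃ ζ₀ ∈ sphere (0 : ℂ) 1, F ζ₀ ≠ c := by
    by_contra! hall
    have := hinj (by simp) (by simp) ((hall 1 (by simp)).trans (hall (-1) (by simp)).symm)
    norm_num at this
  have hsq : 1 ≤ ‖c‖ ^ 2 := one_le_pow₀ hc1
  refine (circleAverage_pos hcont (fun ζ hζ ↦ ?_) hζ₀ ?_).ne' havg
  · have := poissonKernel_pos hz hζ
    rw [hval ζ hζ]
    have : 0 ≤ ‖c‖ ^ 2 - 1 := by linarith
    positivity
  · have := poissonKernel_pos hz hζ₀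
    rw [hval ζ₀ hζ₀]
    have : 0 ≤ ‖c‖ ^ 2 - 1 := by linarith
    have : 0 < ‖F ζ₀ - c‖ := norm_pos_iff.2 (sub_ne_zero.2 hne)
    positivity

/-- A ray from a point of the open unit disk meets the unit circle only once. -/
theorem eq_of_sub_eq_pos_smul_sub {a b w : ℂ} (ha : ‖a‖ = 1) (hb : ‖b‖ = 1) (hw : ‖w‖ < 1)
    {κ : ℝ} (hκ : 0 < κ) (h : a - w = κ * (b - w)) : a = b := by
  have ha' : ‖a‖ ^ 2 = 1 := by rw [ha, one_pow]
  have hb' : ‖b‖ ^ 2 = 1 := by rw [hb, one_pow]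
  have hw' : ‖w‖ ^ 2 < 1 := by nlinarith [norm_nonneg w]
  rw [norm_sq_eq_re_im] at ha' hb' hw'
  have hre := congrArg Complex.re h
  have him := congrArg Complex.im h
  simp only [Complex.sub_re, Complex.sub_im, Complex.mul_re, Complex.mul_im, Complex.ofReal_re,
    Complex.ofReal_im, zero_mul, sub_zero, add_zero] at hre him
  have hare : a.re = w.re + κ * (b.re - w.re) := by linarith
  have haim : a.im = w.im + κ * (b.im - w.im) := by linarith
  rw [hare, haim] at ha'
  -- This is `‖w + κ (b - w)‖² - κ ‖b‖² = 1 - κ`, factored; the second factor is positive because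
  -- `‖w‖ < 1`.
  have hprod : (κ - 1) * (κ * ((b.re - w.re) ^ 2 + (b.im - w.im) ^ 2) +
      (1 - (w.re * w.re + w.im * w.im))) = 0 := by
    linear_combination ha' - κ * hb'
  have hκ1 : κ = 1 := by
    rcases mul_eq_zero.1 hprod with h | h
    · linarith
    · have : 0 ≤ κ * ((b.re - w.re) ^ 2 + (b.im - w.im) ^ 2) := by positivity
      linarith
  rw [hκ1] at h
  simpa using h

/-- The map `f / ‖f‖` into the circle lifts through the covering `Circle.exp`. -/
theorem exists_continuous_angle {A : Type*} [TopologicalSpace A] [SimplyConnectedSpace A]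
    [LocallyPathConnectedSpace A] {f : A → ℂ} (hf : Continuous f) (h0 : ∀ a, f a ≠ 0) :
    ∃ α : A → ℝ, Continuous α ∧ ∀ a, f a = ‖f a‖ * (Circle.exp (α a) : ℂ) := by
  let u : C(A, Circle) := ⟨fun a ↦ ⟨f a / ‖f a‖, by
    simp [Submonoid.unitSphere, h0 a]⟩, by
      refine Continuous.subtype_mk ?_ _
      exact hf.div (by fun_prop) fun a ↦ by simp [h0 a]⟩
  obtain ⟨a₀⟩ : Nonempty A := inferInstance
  obtain ⟨α, ⟨-, hα⟩, -⟩ := Circle.isCoveringMap_exp.existsUnique_continuousMap_lifts u a₀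
    (Complex.arg (u a₀)) (Circle.exp_arg _)
  refine ⟨α, α.continuous, fun a ↦ ?_⟩
  have h1 : Circle.exp (α a) = u a := congrFun hα a
  have h2 : (‖f a‖ : ℂ) ≠ 0 := by simp [h0 a]
  rw [h1]
  change f a = ‖f a‖ * (f a / ‖f a‖)
  field_simp

theorem sub_ne_zero_of_norm_one {x w : ℂ} (hx : ‖x‖ = 1) (hw : ‖w‖ < 1) : x - w ≠ 0 := by
  intro h
  rw [sub_eq_zero] at h
  subst h
  linarith

theorem eq_norm_div_mul {a b u v c : ℂ} (ha : a = ‖a‖ * u) (hb : b = ‖b‖ * v) (hb0 : b ≠ 0)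
    (huv : u = c * v) : a = (‖a‖ / ‖b‖ : ℝ) * (c * b) := by
  have h0 : (‖b‖ : ℂ) ≠ 0 := by simpa using hb0
  push_cast
  generalize (‖a‖ : ℂ) = A at *
  generalize (‖b‖ : ℂ) = B at *
  rw [ha, hb, huv]
  field_simp

/-- The winding number of an injective closed curve on the circle about an interior point does not
vanish. -/
theorem angle_pi_ne_angle_neg_pi {F : ℂ → ℂ} (hmap : MapsTo F (sphere 0 1) (sphere 0 1))
    (hinj : InjOn F (sphere 0 1)) {w : ℂ} (hw : ‖w‖ < 1) {α : ℝ → ℝ} (hα : Continuous α)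
    (h : ∀ s, F (Circle.exp s) - w = ‖F (Circle.exp s) - w‖ * (Circle.exp (α s) : ℂ)) :
    α Real.pi ≠ α (-Real.pi) := by
  intro heq
  have hnorm (s : ℝ) : ‖F (Circle.exp s)‖ = 1 :=
    mem_sphere_zero_iff_norm.1 (hmap (Circle.exp s).2)
  have hpos (s : ℝ) : 0 < ‖F (Circle.exp s) - w‖ :=
    norm_pos_iff.2 (sub_ne_zero_of_norm_one (hnorm s) hw)
  have hα_inj : ∀ s ∈ Ico (-Real.pi) Real.pi, ∀ t ∈ Ico (-Real.pi) Real.pi,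
      α s = α t → s = t := by
    intro s hs t ht hst
    have h1 : F (Circle.exp s) - w =
        (‖F (Circle.exp s) - w‖ / ‖F (Circle.exp t) - w‖ : ℝ) * (F (Circle.exp t) - w) := by
      have := eq_norm_div_mul (c := 1) (h s) (h t) (norm_pos_iff.1 (hpos t)) (by rw [hst, one_mul])
      rwa [one_mul] at this
    have h2 := eq_of_sub_eq_pos_smul_sub (hnorm s) (hnorm t) hw (div_pos (hpos s) (hpos t)) h1
    have h3 : Circle.exp s = Circle.exp t :=
      Subtype.ext (hinj (Circle.exp s).2 (Circle.exp t).2 h2)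
    obtain ⟨m, hm⟩ := Circle.exp_eq_exp.1 h3
    have hpi := Real.pi_pos
    have hm0 : m = 0 := by
      have h4 : (m : ℝ) * (2 * Real.pi) < 1 * (2 * Real.pi) := by linarith [hs.2, ht.1]
      have h5 : (-1 : ℝ) * (2 * Real.pi) < m * (2 * Real.pi) := by linarith [hs.1, ht.2]
      have h6 := lt_of_mul_lt_mul_right h4 (by positivity)
      have h7 := lt_of_mul_lt_mul_right h5 (by positivity)
      have h8 : m < 1 := by exact_mod_cast h6
      have h9 : -1 < m := by exact_mod_cast h7
      omega
    simpa [hm0] using hm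
  have hpi := Real.pi_pos
  have hne : α 0 ≠ α (-Real.pi) := fun h0 ↦ by
    have := hα_inj 0 ⟨by linarith, hpi⟩ (-Real.pi) ⟨le_rfl, by linarith⟩ h0
    linarith
  -- If the angle returned to its initial value, it would take the midpoint value on both sides of
  -- `0`, against injectivity on `[-π, π)`.
  have hm1 : (α 0 + α (-Real.pi)) / 2 ∈ α '' Ioo (-Real.pi) 0 := by
    rcases lt_or_gt_of_ne hne with hlt | hlt
    · exact intermediate_value_Ioo' (by linarith) hα.continuousOn ⟨by linarith, by linarith⟩
    · exact intermediate_value_Ioo (by linarith) hα.continuousOn ⟨by linarith, by linarith⟩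
  have hm2 : (α 0 + α (-Real.pi)) / 2 ∈ α '' Ioo 0 Real.pi := by
    rcases lt_or_gt_of_ne hne with hlt | hlt
    · exact intermediate_value_Ioo (by linarith) hα.continuousOn ⟨by linarith, by linarith⟩
    · exact intermediate_value_Ioo' (by linarith) hα.continuousOn ⟨by linarith, by linarith⟩
  obtain ⟨x, hx, hx'⟩ := hm1
  obtain ⟨y, hy, hy'⟩ := hm2
  have := hα_inj x ⟨hx.1.le, by linarith [hx.2]⟩ y ⟨by linarith [hy.1], hy.2⟩ (hx'.trans hy'.symm)
  linarith [hx.2, hy.1]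

theorem continuous_comp_circleExp {F : ℂ → ℂ} (hF : ContinuousOn F (sphere 0 1)) :
    Continuous fun s : ℝ ↦ F (Circle.exp s) :=
  (continuousOn_sphere_iff_comp_coe.1 hF).comp Circle.exp.continuous

/-- Some chord through the interior point `w` has end points whose parameters are symmetric with
respect to the real axis. -/
theorem exists_symmetric_chord {F : ℂ → ℂ} (hF : ContinuousOn F (sphere 0 1))
    (hmap : MapsTo F (sphere 0 1) (sphere 0 1)) (hinj : InjOn F (sphere 0 1)) {w : ℂ}
    (hw : ‖w‖ < 1) :
    ∃ s ∈ Ioo 0 Real.pi, ∃ κ : ℝ, 0 < κ ∧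
      F (Circle.exp s) - w = -(κ * (F (Circle.exp (-s)) - w)) := by
  have hnorm (s : ℝ) : ‖F (Circle.exp s)‖ = 1 :=
    mem_sphere_zero_iff_norm.1 (hmap (Circle.exp s).2)
  have hpos (s : ℝ) : 0 < ‖F (Circle.exp s) - w‖ :=
    norm_pos_iff.2 (sub_ne_zero_of_norm_one (hnorm s) hw)
  obtain ⟨α, hα, h⟩ := exists_continuous_angle (f := fun s : ℝ ↦ F (Circle.exp s) - w)
    ((continuous_comp_circleExp hF).sub continuous_const)
    (fun s ↦ sub_ne_zero_of_norm_one (hnorm s) hw)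
  have hne := angle_pi_ne_angle_neg_pi hmap hinj hw hα h
  have hpi := Real.pi_pos
  obtain ⟨m, hm⟩ : ∃ m : ℤ, α Real.pi = α (-Real.pi) + m * (2 * Real.pi) := by
    rw [← Circle.exp_eq_exp]
    have h1 : Circle.exp (-Real.pi) = Circle.exp Real.pi := by
      rw [← Circle.periodic_exp (-Real.pi)]; congr 1; ring
    have h2 := h (-Real.pi)
    have h3 := h Real.pi
    rw [h1] at h2
    have h4 : (‖F (Circle.exp Real.pi) - w‖ : ℂ) ≠ 0 := by exact_mod_cast (hpos _).ne'
    exact Subtype.ext (mul_left_cancel₀ h4 (h3.symm.trans h2))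
  have hm0 : m ≠ 0 := by rintro rfl; simp at hm; exact hne hm
  -- This difference runs from `0` to `2πm` with `m ≠ 0`, so it takes the value `π` or `-π`; there
  -- the two directions seen from `w` are opposite.
  have hβ : ContinuousOn (fun s ↦ α s - α (-s)) (Icc 0 Real.pi) := by fun_prop
  obtain ⟨s, hs, hs'⟩ : ∃ s ∈ Ioo 0 Real.pi,
      Circle.exp (α s) = Circle.exp (α (-s) + Real.pi) := by
    rcases lt_or_gt_of_ne hm0 with hlt | hlt
    · have hm1 : (m : ℝ) ≤ -1 := by exact_mod_cast Int.le_sub_one_of_lt hlt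
      obtain ⟨s, hs, hs'⟩ := intermediate_value_Ioo' hpi.le hβ
        (show -Real.pi ∈ _ from ⟨by simp only [hm]; nlinarith, by simpa using hpi⟩)
      refine ⟨s, hs, Circle.exp_eq_exp.2 ⟨-1, ?_⟩⟩
      push_cast
      linarith
    · have hm1 : (1 : ℝ) ≤ m := by exact_mod_cast hlt
      obtain ⟨s, hs, hs'⟩ := intermediate_value_Ioo hpi.le hβ
        (show Real.pi ∈ _ from ⟨by simpa using hpi, by simp only [hm]; nlinarith⟩)
      refine ⟨s, hs, Circle.exp_eq_exp.2 ⟨0, ?_⟩⟩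
      push_cast
      linarith
  refine ⟨s, hs, _, div_pos (hpos s) (hpos (-s)), ?_⟩
  have h5 : (Circle.exp (α s) : ℂ) = -1 * Circle.exp (α (-s)) := by
    rw [hs', Circle.exp_add]
    simp
  have h6 := eq_norm_div_mul (h s) (h (-s)) (norm_pos_iff.1 (hpos _)) h5
  rwa [neg_one_mul, mul_neg] at h6

theorem forall_pos_or_forall_neg_of_ne_zero {V : ℝ → ℝ} (hV : Continuous V) {a b : ℝ}
    (h0 : ∀ t ∈ Ioo a b, V t ≠ 0) : (∀ t ∈ Ioo a b, 0 < V t) ∨ ∀ t ∈ Ioo a b, V t < 0 := by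
  by_contra! h
  obtain ⟨⟨x, hx, hVx⟩, ⟨y, hy, hVy⟩⟩ := h
  obtain ⟨z, hz, hz'⟩ := isPreconnected_Ioo.intermediate_value hx hy hV.continuousOn ⟨hVx, hVy⟩
  exact h0 z hz hz'

theorem poissonKernel_ofReal_circleExp (r t : ℝ) :
    poissonKernel 0 (r : ℂ) (Circle.exp t) = (1 - r ^ 2) / (1 - 2 * r * Real.cos t + r ^ 2) := by
  rw [poissonKernel_def]
  simp only [sub_zero, Circle.norm_coe, one_pow, Complex.norm_real, Real.norm_eq_abs, sq_abs]
  congr 1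
  rw [norm_sq_eq_re_im, Circle.coe_exp]
  simp only [Complex.sub_re, Complex.sub_im, Complex.exp_ofReal_mul_I_re,
    Complex.exp_ofReal_mul_I_im, Complex.ofReal_re, Complex.ofReal_im]
  nlinarith [Real.sin_sq_add_cos_sq t]

theorem one_sub_two_mul_cos_pos {r : ℝ} (hr : r < 1) (hr0 : 0 < r) (t : ℝ) :
    0 < 1 - 2 * r * Real.cos t + r ^ 2 := by
  nlinarith [Real.cos_le_one t, sq_nonneg (1 - r), mul_pos hr0 hr0]

theorem cos_lt_cos_of_mem_Ioo_neg {s t : ℝ} (hs : s ∈ Ioo 0 Real.pi) (ht : t ∈ Ioo (-s) s) :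
    Real.cos s < Real.cos t := by
  rw [← Real.cos_abs t]
  exact Real.cos_lt_cos_of_nonneg_of_le_pi (abs_nonneg t) hs.2.le (abs_lt.2 ht)

theorem cos_lt_cos_of_mem_Ioo_two_pi_sub {s t : ℝ} (hs : s ∈ Ioo 0 Real.pi)
    (ht : t ∈ Ioo s (2 * Real.pi - s)) : Real.cos t < Real.cos s := by
  rcases le_total t Real.pi with h | h
  · exact Real.cos_lt_cos_of_nonneg_of_le_pi hs.1.le h ht.1
  · rw [← Real.cos_two_pi_sub t]
    exact Real.cos_lt_cos_of_nonneg_of_le_pi hs.1.le (by linarith) (by linarith [ht.2])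

theorem exists_circleExp_eq_mem_Ico {s : ℝ} (hs : s ∈ Ioo 0 Real.pi) (ζ : Circle) :
    ∃ t ∈ Ico (-s) (2 * Real.pi - s), Circle.exp t = ζ := by
  have h := Complex.arg_mem_Ioc (ζ : ℂ)
  by_cases hc : -s ≤ Complex.arg ζ
  · exact ⟨_, ⟨hc, by linarith [h.2, hs.2]⟩, Circle.exp_arg ζ⟩
  · refine ⟨Complex.arg ζ + 2 * Real.pi, ⟨by linarith [h.1, hs.1, hs.2, Real.pi_pos],
      by linarith⟩, ?_⟩
    rw [Circle.periodic_exp, Circle.exp_arg]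

/-- The core of injectivity. The chord is taken with conjugate parameters because `e^{it}` and
`e^{-it}` lie on the same level of the Poisson kernel of a real point. -/
theorem apply_zero_ne_apply_ofReal {F : ℂ → ℂ} (hF : HarmonicContOnCl F (ball 0 1))
    (hmap : MapsTo F (sphere 0 1) (sphere 0 1)) (hinj : InjOn F (sphere 0 1)) {r : ℝ}
    (hr0 : 0 < r) (hr1 : r < 1) : F 0 ≠ F r := by
  intro h0r
  set w := F 0 with hwdef
  have hw : ‖w‖ < 1 := by
    simpa using mapsTo_ball_of_harmonicContOnCl hF hmap hinj (x := 0) (by simp)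
  have hS : ContinuousOn F (sphere 0 1) := hF.continuousOn_ball.mono sphere_subset_closedBall
  have hr : (r : ℂ) ∈ ball (0 : ℂ) 1 := by simpa [abs_of_pos hr0] using hr1
  have hnorm (s : ℝ) : ‖F (Circle.exp s)‖ = 1 :=
    mem_sphere_zero_iff_norm.1 (hmap (Circle.exp s).2)
  have hne (s : ℝ) : F (Circle.exp s) - w ≠ 0 := sub_ne_zero_of_norm_one (hnorm s) hw
  obtain ⟨s, hs, κ, hκ, hsκ⟩ := exists_symmetric_chord hS hmap hinj hw
  set L := imConjMul (F (Circle.exp s) - w) with hL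
  have hcos (t t' : ℝ) (h : F (Circle.exp t) = F (Circle.exp t')) :
      Real.cos t = Real.cos t' := by
    have h1 : (Circle.exp t : ℂ) = Circle.exp t' :=
      hinj (Circle.exp t).2 (Circle.exp t').2 h
    have h2 := congrArg Complex.re h1
    rwa [Circle.coe_exp, Circle.coe_exp, Complex.exp_ofReal_mul_I_re,
      Complex.exp_ofReal_mul_I_re] at h2
  -- The line through `w` along the chord meets the circle only at the two chord end points, since
  -- each ray from `w` meets it once.
  have hzero (t : ℝ) (ht : L (F (Circle.exp t) - w) = 0) : Real.cos t = Real.cos s := by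
    obtain ⟨μ, hμ⟩ : ∃ μ : ℝ, F (Circle.exp t) - w = μ * (F (Circle.exp s) - w) := by
      have hb := hne s
      rw [hL, imConjMul_apply] at ht
      generalize F (Circle.exp s) - w = b at *
      generalize F (Circle.exp t) - w = a at *
      refine ⟨(b.re * a.re + b.im * a.im) / (b.re * b.re + b.im * b.im), ?_⟩
      have hb2 : b.re * b.re + b.im * b.im ≠ 0 := by
        rw [← norm_sq_eq_re_im]; positivity
      apply Complex.ext
      · simp only [Complex.mul_re, Complex.ofReal_re, Complex.ofReal_im, zero_mul, sub_zero]
        rw [div_mul_eq_mul_div, eq_div_iff hb2]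
        linear_combination (-b.im) * ht
      · simp only [Complex.mul_im, Complex.ofReal_re, Complex.ofReal_im, zero_mul, add_zero]
        rw [div_mul_eq_mul_div, eq_div_iff hb2]
        linear_combination b.re * ht
    rcases lt_trichotomy μ 0 with hneg | hz | hpos
    · have h1 : F (Circle.exp t) - w = (-μ * κ : ℝ) * (F (Circle.exp (-s)) - w) := by
        rw [hμ, hsκ]; push_cast; ring
      have h2 := eq_of_sub_eq_pos_smul_sub (hnorm t) (hnorm _) hw
        (mul_pos (neg_pos.2 hneg) hκ) h1
      rw [hcos _ _ h2, Real.cos_neg]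
    · exact absurd (by simpa [hz] using hμ) (hne t)
    · exact hcos _ _ (eq_of_sub_eq_pos_smul_sub (hnorm t) (hnorm s) hw hpos hμ)
  have hs0 : L (F (Circle.exp s) - w) = 0 := by rw [hL, imConjMul_apply]; ring
  have hs0' : L (F (Circle.exp (-s)) - w) = 0 := by
    have h1 : L (κ • (F (Circle.exp (-s)) - w)) = 0 := by
      rw [Complex.real_smul, ← neg_neg ((κ : ℂ) * _), ← hsκ, map_neg, hs0, neg_zero]
    rw [map_smul, smul_eq_mul] at h1
    exact (mul_eq_zero.1 h1).resolve_left hκ.ne'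
  have hVS : ContinuousOn (fun ζ ↦ L (F ζ - w)) (sphere 0 1) :=
    L.continuous.comp_continuousOn (hS.sub continuousOn_const)
  have hV : Continuous fun t : ℝ ↦ L (F (Circle.exp t) - w) := (continuousOn_sphere_iff_comp_coe.1 hVS).comp Circle.exp.continuous
  have hPS := continuousOn_poissonKernel_sphere hr
  have avg1 : Real.circleAverage (fun ζ ↦ L (F ζ - w)) 0 1 = 0 := by
    rw [circleAverage_clm hF, sub_self, map_zero]
  have avg2 : Real.circleAverage (fun ζ ↦ poissonKernel 0 (r : ℂ) ζ * L (F ζ - w)) 0 1 = 0 := by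
    rw [circleAverage_poissonKernel_smul_clm hF L w hr, ← h0r, sub_self, map_zero]
  have avg (a b : ℝ) : Real.circleAverage
      (fun ζ ↦ (a * poissonKernel 0 (r : ℂ) ζ + b) * L (F ζ - w)) 0 1 = 0 := by
    have e : (fun ζ ↦ (a * poissonKernel 0 (r : ℂ) ζ + b) * L (F ζ - w)) =
        a • (fun ζ ↦ poissonKernel 0 (r : ℂ) ζ * L (F ζ - w)) + b • fun ζ ↦ L (F ζ - w) := by
      ext ζ; simp; ring
    have i1 : CircleIntegrable
        (a • fun ζ ↦ poissonKernel 0 (r : ℂ) ζ * L (F ζ - w)) 0 1 :=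
      circleIntegrable_of_continuousOn ((hPS.mul hVS).const_smul _)
    have i2 : CircleIntegrable (b • fun ζ ↦ L (F ζ - w)) 0 1 :=
      circleIntegrable_of_continuousOn (hVS.const_smul _)
    rw [e, Real.circleAverage_add i1 i2, Real.circleAverage_smul,
      Real.circleAverage_smul, avg1, avg2]
    simp
  -- No weight `a P + b` may have the sign of `L (F - w)` on both open arcs: the weighted mean is
  -- `0` for all `a` and `b`.
  have contra (a b : ℝ)
      (h1 : ∀ t ∈ Ioo (-s) s, 0 < (a * poissonKernel 0 (r : ℂ) (Circle.exp t) + b) *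
        L (F (Circle.exp t) - w))
      (h2 : ∀ t ∈ Ioo s (2 * Real.pi - s), 0 <
        (a * poissonKernel 0 (r : ℂ) (Circle.exp t) + b) * L (F (Circle.exp t) - w)) :
      False := by
    refine (circleAverage_pos (((hPS.const_mul a).add continuousOn_const).mul hVS)
      (fun ζ hζ ↦ ?_) (Circle.exp 0).2 (h1 0 ⟨by linarith [hs.1], hs.1⟩)).ne' (avg a b)
    obtain ⟨t, ht, htζ⟩ := exists_circleExp_eq_mem_Ico hs ⟨ζ, hζ⟩
    have htζ' : ζ = Circle.exp t := (congrArg Subtype.val htζ).symm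
    rw [htζ']
    change 0 ≤ (a * poissonKernel 0 (r : ℂ) (Circle.exp t) + b) * L (F (Circle.exp t) - w)
    rcases eq_or_lt_of_le ht.1 with h | h
    · rw [← h, hs0', mul_zero]
    · rcases lt_trichotomy t s with h' | h' | h'
      · exact (h1 t ⟨h, h'⟩).le
      · rw [h', hs0, mul_zero]
      · exact (h2 t ⟨h', ht.2⟩).le
  have hT1 (t : ℝ) (ht : t ∈ Ioo (-s) s) :
      0 < poissonKernel 0 (r : ℂ) (Circle.exp t) - poissonKernel 0 (r : ℂ) (Circle.exp s) := by
    rw [poissonKernel_ofReal_circleExp, poissonKernel_ofReal_circleExp, sub_pos]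
    have h1 := cos_lt_cos_of_mem_Ioo_neg hs ht
    have h2 := one_sub_two_mul_cos_pos hr1 hr0 t
    have h3 : 0 < 1 - r ^ 2 := by nlinarith
    apply div_lt_div_of_pos_left h3 h2
    nlinarith
  have hT2 (t : ℝ) (ht : t ∈ Ioo s (2 * Real.pi - s)) :
      poissonKernel 0 (r : ℂ) (Circle.exp t) - poissonKernel 0 (r : ℂ) (Circle.exp s) < 0 := by
    rw [poissonKernel_ofReal_circleExp, poissonKernel_ofReal_circleExp, sub_neg]
    have h1 := cos_lt_cos_of_mem_Ioo_two_pi_sub hs ht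
    have h2 := one_sub_two_mul_cos_pos hr1 hr0 s
    have h3 : 0 < 1 - r ^ 2 := by nlinarith
    apply div_lt_div_of_pos_left h3 h2
    nlinarith
  have hsign1 := forall_pos_or_forall_neg_of_ne_zero hV (a := -s) (b := s)
    fun t ht h ↦ (cos_lt_cos_of_mem_Ioo_neg hs ht).ne' (hzero t h)
  have hsign2 := forall_pos_or_forall_neg_of_ne_zero hV (a := s) (b := 2 * Real.pi - s)
    fun t ht h ↦ (cos_lt_cos_of_mem_Ioo_two_pi_sub hs ht).ne (hzero t h)
  -- Equal signs on the two arcs call for the weight `±1`, opposite signs for `±(P - C)`, which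
  -- changes sign exactly where `L (F - w)` does.
  set C := poissonKernel 0 (r : ℂ) (Circle.exp s)
  rcases hsign1 with h1 | h1 <;> rcases hsign2 with h2 | h2
  · exact contra 0 1 (fun t ht ↦ by simpa using h1 t ht) (fun t ht ↦ by simpa using h2 t ht)
  · refine contra 1 (-C) (fun t ht ↦ ?_) (fun t ht ↦ ?_)
    · have := mul_pos (hT1 t ht) (h1 t ht); linarith
    · have := mul_pos_of_neg_of_neg (hT2 t ht) (h2 t ht); linarith
  · refine contra (-1) C (fun t ht ↦ ?_) (fun t ht ↦ ?_)
    · have := mul_neg_of_pos_of_neg (hT1 t ht) (h1 t ht); linarith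
    · have := mul_neg_of_neg_of_pos (hT2 t ht) (h2 t ht); linarith
  · exact contra 0 (-1) (fun t ht ↦ by simpa using h1 t ht) (fun t ht ↦ by simpa using h2 t ht)

/-! ### Möbius reduction, injectivity, surjectivity and the homeomorphism. -/

/-- Locally `f` is the real part of an analytic function, and this survives composition with `g`. -/
theorem harmonicAt_comp_analyticAt {f : ℂ → ℝ} {g : ℂ → ℂ} {z : ℂ}
    (hf : HarmonicAt f (g z)) (hg : AnalyticAt ℂ g z) : HarmonicAt (fun x ↦ f (g x)) z := by
  obtain ⟨ε, hε, hε'⟩ := isOpen_iff.1 (isOpen_setOfPred_harmonicAt (f := f)) (g z) hf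
  obtain ⟨Φ, hΦ, hre⟩ := HarmonicOnNhd.exists_analyticOnNhd_ball_re_eq (fun _ hy ↦ hε' hy)
  have h1 : AnalyticAt ℂ (fun x ↦ Φ (g x)) z := (hΦ (g z) (mem_ball_self hε)).comp hg
  refine (harmonicAt_congr_nhds ?_).2 h1.harmonicAt_re
  filter_upwards [hg.continuousAt.preimage_mem_nhds (ball_mem_nhds (g z) hε)] with x hx
  exact (hre hx).symm

theorem harmonicContOnCl_comp_analytic {F g : ℂ → ℂ} (hF : HarmonicContOnCl F (ball 0 1))
    (hg : AnalyticOnNhd ℂ g (closedBall 0 1)) (hmap : MapsTo g (ball 0 1) (ball 0 1))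
    (hmap' : MapsTo g (sphere 0 1) (sphere 0 1)) :
    HarmonicContOnCl (fun z ↦ F (g z)) (ball 0 1) := by
  refine .mk_ball (harmonicOnNhd_of_re_im (fun z hz ↦ ?_) fun z hz ↦ ?_) ?_
  · exact harmonicAt_comp_analyticAt (f := fun z ↦ (F z).re)
      ((hF.1 _ (hmap hz)).comp_CLM Complex.reCLM) (hg z (ball_subset_closedBall hz))
  · exact harmonicAt_comp_analyticAt (f := fun z ↦ (F z).im)
      ((hF.1 _ (hmap hz)).comp_CLM Complex.imCLM) (hg z (ball_subset_closedBall hz))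
  · refine hF.continuousOn_ball.comp hg.continuousOn ?_
    rw [← ball_union_sphere]
    exact hmap.union_union hmap'

/-- The Möbius automorphism of the unit disk sending `0` to `a`. -/
noncomputable def diskMoebius (a ζ : ℂ) : ℂ := (ζ + a) / (1 + starRingEnd ℂ a * ζ)

theorem one_add_conj_mul_ne_zero {a ζ : ℂ} (ha : ‖a‖ < 1) (hζ : ‖ζ‖ ≤ 1) :
    1 + starRingEnd ℂ a * ζ ≠ 0 := by
  intro h
  have h1 : starRingEnd ℂ a * ζ = -1 := by linear_combination h
  have h2 := congrArg norm h1
  rw [norm_mul, RCLike.norm_conj, norm_neg, norm_one] at h2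
  nlinarith [norm_nonneg a, norm_nonneg ζ]

theorem one_sub_norm_diskMoebius_sq {a ζ : ℂ} (ha : ‖a‖ < 1) (hζ : ‖ζ‖ ≤ 1) :
    1 - ‖diskMoebius a ζ‖ ^ 2 =
      (1 - ‖a‖ ^ 2) * (1 - ‖ζ‖ ^ 2) / ‖1 + starRingEnd ℂ a * ζ‖ ^ 2 := by
  have h0 : ‖1 + starRingEnd ℂ a * ζ‖ ^ 2 ≠ 0 := by
    have := norm_ne_zero_iff.2 (one_add_conj_mul_ne_zero ha hζ)
    positivity
  rw [diskMoebius, norm_div, div_pow, one_sub_div h0]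
  congr 1
  simp only [norm_sq_eq_re_im, Complex.add_re, Complex.add_im, Complex.mul_re, Complex.mul_im,
    Complex.one_re, Complex.one_im, Complex.conj_re, Complex.conj_im]
  ring

theorem mapsTo_diskMoebius_ball {a : ℂ} (ha : ‖a‖ < 1) :
    MapsTo (diskMoebius a) (ball 0 1) (ball 0 1) := by
  intro ζ hζ
  rw [mem_ball_zero_iff] at hζ ⊢
  have h := one_sub_norm_diskMoebius_sq ha hζ.le
  have h1 := norm_pos_iff.2 (one_add_conj_mul_ne_zero ha hζ.le)
  have h2 : 0 < 1 - ‖a‖ ^ 2 := by nlinarith [norm_nonneg a]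
  have h3 : 0 < 1 - ‖ζ‖ ^ 2 := by nlinarith [norm_nonneg ζ]
  have h4 : 0 < 1 - ‖diskMoebius a ζ‖ ^ 2 := by rw [h]; positivity
  nlinarith [norm_nonneg (diskMoebius a ζ)]

theorem mapsTo_diskMoebius_sphere {a : ℂ} (ha : ‖a‖ < 1) :
    MapsTo (diskMoebius a) (sphere 0 1) (sphere 0 1) := by
  intro ζ hζ
  rw [mem_sphere_zero_iff_norm] at hζ ⊢
  have h := one_sub_norm_diskMoebius_sq ha hζ.le
  rw [hζ] at h
  simp only [one_pow, sub_self, mul_zero, zero_div] at h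
  nlinarith [norm_nonneg (diskMoebius a ζ)]

theorem diskMoebius_diskMoebius_neg {a ζ : ℂ} (ha : ‖a‖ < 1) (hζ : ‖ζ‖ ≤ 1) :
    diskMoebius a (diskMoebius (-a) ζ) = ζ := by
  have h1 : 1 + starRingEnd ℂ (-a) * ζ ≠ 0 := one_add_conj_mul_ne_zero (by simpa using ha) hζ
  have h2 : 1 + starRingEnd ℂ a * (-a) ≠ 0 :=
    one_add_conj_mul_ne_zero ha (by simpa using ha.le)
  rw [diskMoebius, diskMoebius]
  simp only [map_neg] at h1 ⊢
  generalize starRingEnd ℂ a = c at *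
  have e1 : (ζ + -a) / (1 + -c * ζ) + a = ζ * (1 + c * -a) / (1 + -c * ζ) := by
    rw [eq_div_iff h1, add_mul, div_mul_cancel₀ _ h1]; ring
  have e2 : 1 + c * ((ζ + -a) / (1 + -c * ζ)) = (1 + c * -a) / (1 + -c * ζ) := by
    rw [eq_div_iff h1, add_mul, mul_assoc, div_mul_cancel₀ _ h1]; ring
  rw [e1, e2, div_div_div_cancel_right₀ h1, mul_div_cancel_right₀ _ h2]

theorem injOn_diskMoebius {a : ℂ} (ha : ‖a‖ < 1) :
    InjOn (diskMoebius a) (closedBall 0 1) := by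
  intro x hx y hy h
  rw [mem_closedBall_zero_iff] at hx hy
  have e1 := diskMoebius_diskMoebius_neg (a := -a) (by simpa using ha) hx
  have e2 := diskMoebius_diskMoebius_neg (a := -a) (by simpa using ha) hy
  rw [neg_neg] at e1 e2
  rw [← e1, ← e2, h]

theorem analyticOnNhd_diskMoebius {a : ℂ} (ha : ‖a‖ < 1) :
    AnalyticOnNhd ℂ (diskMoebius a) (closedBall 0 1) := by
  intro ζ hζ
  refine AnalyticAt.div (by fun_prop) (by fun_prop) ?_
  exact one_add_conj_mul_ne_zero ha (by simpa using hζ)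

/-- Precomposing with `ζ ↦ diskMoebius a (u * ζ)`, where `u` is the direction of `b`, moves the pair
`a`, `z` to `0`, `‖b‖` and keeps the hypotheses on `F`. -/
theorem injOn_ball_of_harmonicContOnCl {F : ℂ → ℂ} (hF : HarmonicContOnCl F (ball 0 1))
    (hmap : MapsTo F (sphere 0 1) (sphere 0 1)) (hinj : InjOn F (sphere 0 1)) :
    InjOn F (ball 0 1) := by
  intro a ha z hz haz
  by_contra hne
  have ha' : ‖a‖ < 1 := by simpa using ha
  have hz' : ‖z‖ < 1 := by simpa using hz
  set b := diskMoebius (-a) z with hbdef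
  have hb1 : ‖b‖ < 1 := by
    simpa using mapsTo_diskMoebius_ball (a := -a) (by simpa using ha') hz
  have hab : diskMoebius a b = z := diskMoebius_diskMoebius_neg ha' hz'.le
  have hb0 : b ≠ 0 := by
    intro h
    rw [h] at hab
    apply hne
    simpa [diskMoebius] using hab
  have hbn : (‖b‖ : ℂ) ≠ 0 := by simpa using hb0
  set u := b / ‖b‖ with hudef
  have hu : ‖u‖ = 1 := by simp [hudef, hb0]
  have hu0 : u ≠ 0 := norm_ne_zero_iff.1 (by rw [hu]; exact one_ne_zero)
  have hrot_ball : MapsTo (u * ·) (ball 0 1) (ball (0 : ℂ) 1) := fun ζ hζ ↦ by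
    simpa [hu] using hζ
  have hrot_sphere : MapsTo (u * ·) (sphere 0 1) (sphere (0 : ℂ) 1) := fun ζ hζ ↦ by
    simpa [hu] using hζ
  have hrot_closedBall : MapsTo (u * ·) (closedBall 0 1) (closedBall (0 : ℂ) 1) := fun ζ hζ ↦ by
    simpa [hu] using hζ
  have hG := harmonicContOnCl_comp_analytic hF (g := fun ζ ↦ diskMoebius a (u * ζ))
    ((analyticOnNhd_diskMoebius ha').comp (fun _ _ ↦ by fun_prop) hrot_closedBall)
    ((mapsTo_diskMoebius_ball ha').comp hrot_ball)
    ((mapsTo_diskMoebius_sphere ha').comp hrot_sphere)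
  have hmapM : MapsTo (fun ζ ↦ diskMoebius a (u * ζ)) (sphere 0 1) (sphere 0 1) :=
    (mapsTo_diskMoebius_sphere ha').comp hrot_sphere
  have hinjM : InjOn (fun ζ ↦ diskMoebius a (u * ζ)) (sphere 0 1) :=
    ((injOn_diskMoebius ha').mono sphere_subset_closedBall).comp
      (mul_right_injective₀ hu0).injOn hrot_sphere
  have key := apply_zero_ne_apply_ofReal hG (hmap.comp hmapM) (hinj.comp hinjM hmapM)
    (norm_pos_iff.2 hb0) hb1
  apply key
  have e1 : diskMoebius a (u * 0) = a := by simp [diskMoebius]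
  have e2 : u * (‖b‖ : ℂ) = b := by rw [hudef]; field_simp
  simp only [e1, e2, hab, haz]

/-- If `w` were omitted, the winding number about `w` of the image of the circle of radius `t` would
not depend on `t`; it is zero at `t = 0` and nonzero at `t = 1`. -/
theorem surjOn_ball_of_harmonicContOnCl {F : ℂ → ℂ} (hF : HarmonicContOnCl F (ball 0 1))
    (hmap : MapsTo F (sphere 0 1) (sphere 0 1)) (hinj : InjOn F (sphere 0 1)) :
    SurjOn F (closedBall 0 1) (ball 0 1) := by
  intro w hw
  by_contra hnot
  have hw' : ‖w‖ < 1 := by simpa using hw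
  -- Clamping the radius with `projIcc` makes the whole plane, which is simply connected, the
  -- parameter space.
  have hdisk (q : ℝ × ℝ) : ((projIcc (0 : ℝ) 1 zero_le_one q.2 : ℝ) : ℂ) * Circle.exp q.1 ∈
      closedBall (0 : ℂ) 1 := by
    have := (projIcc (0 : ℝ) 1 zero_le_one q.2).2
    simp [abs_of_nonneg this.1, this.2]
  have hcont : Continuous fun q : ℝ × ℝ ↦
      F (((projIcc (0 : ℝ) 1 zero_le_one q.2 : ℝ) : ℂ) * Circle.exp q.1) - w := by
    refine Continuous.sub (hF.continuousOn_ball.comp_continuous ?_ hdisk) continuous_const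
    have : Continuous fun q : ℝ × ℝ ↦ projIcc (0 : ℝ) 1 zero_le_one q.2 :=
      continuous_projIcc.comp continuous_snd
    fun_prop
  obtain ⟨α, hα, h⟩ := exists_continuous_angle hcont fun q hq ↦
    hnot ⟨_, hdisk q, sub_eq_zero.1 hq⟩
  have hexp (q q' : ℝ × ℝ)
      (hqq : ((projIcc (0 : ℝ) 1 zero_le_one q.2 : ℝ) : ℂ) * Circle.exp q.1 =
        ((projIcc (0 : ℝ) 1 zero_le_one q'.2 : ℝ) : ℂ) * Circle.exp q'.1) :
      Circle.exp (α q) = Circle.exp (α q') := by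
    have h1 := h q
    have h2 := h q'
    rw [hqq] at h1
    refine Subtype.ext (mul_left_cancel₀ ?_ (h1.symm.trans h2))
    simp only [ne_eq, Complex.ofReal_eq_zero, norm_eq_zero]
    exact fun hq ↦ hnot ⟨_, hdisk q', sub_eq_zero.1 hq⟩
  have hcov := Circle.isCoveringMap_exp
  have c1 : α (Real.pi, 0) = α (-Real.pi, 0) :=
    hcov.const_of_comp (g := fun s : ℝ ↦ α (s, 0)) (by fun_prop)
      (fun s s' ↦ hexp _ _ (by simp)) _ _
  have hpi : Circle.exp Real.pi = Circle.exp (-Real.pi) := by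
    rw [← Circle.periodic_exp (-Real.pi)]; congr 1; ring
  -- The total change of angle is continuous in the radius and lies in `2πℤ`, hence is constant.
  have c2 : α (Real.pi, 1) - α (-Real.pi, 1) = α (Real.pi, 0) - α (-Real.pi, 0) := by
    refine hcov.const_of_comp (g := fun t : ℝ ↦ α (Real.pi, t) - α (-Real.pi, t)) (by fun_prop)
      (fun s s' ↦ ?_) _ _
    have e (t : ℝ) : Circle.exp (α (Real.pi, t) - α (-Real.pi, t)) = 1 := by
      rw [Circle.exp_sub, hexp (Real.pi, t) (-Real.pi, t) (by simp only [hpi]), div_self']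
    rw [e, e]
  refine angle_pi_ne_angle_neg_pi hmap hinj hw' (α := fun s ↦ α (s, 1)) (by fun_prop)
    (fun s ↦ ?_) (by linarith)
  have := h (s, 1)
  simpa [projIcc_right] using this

/-- **Radó–Kneser–Choquet theorem** for bijective boundary values. -/
theorem bijOn_closedBall_of_harmonicContOnCl {F : ℂ → ℂ} (hF : HarmonicContOnCl F (ball 0 1))
    (hbij : BijOn F (sphere 0 1) (sphere 0 1)) : BijOn F (closedBall 0 1) (closedBall 0 1) := by
  have hball := mapsTo_ball_of_harmonicContOnCl hF hbij.mapsTo hbij.injOn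
  have hsurj := surjOn_ball_of_harmonicContOnCl hF hbij.mapsTo hbij.injOn
  refine ⟨?_, ?_, ?_⟩
  · rw [← ball_union_sphere]
    exact hball.union_union hbij.mapsTo
  · rw [← ball_union_sphere]
    refine (injOn_union sphere_disjoint_ball.symm).2 ⟨injOn_ball_of_harmonicContOnCl hF hbij.mapsTo
      hbij.injOn, hbij.injOn, fun x hx y hy hxy ↦ ?_⟩
    exact disjoint_left.1 (sphere_disjoint_ball (x := (0 : ℂ)) (ε := 1)).symm (hball hx)
      (hxy ▸ hbij.mapsTo hy)
  · rw [← ball_union_sphere (ε := 1)]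
    rw [← ball_union_sphere] at hsurj
    exact hsurj.union (hbij.surjOn.mono subset_union_right subset_rfl)

theorem bijOn_harmonicExtension_sphere (φ : Circle ≃ Circle) :
    BijOn (harmonicExtension φ) (sphere 0 1) (sphere 0 1) := by
  refine ⟨fun ζ hζ ↦ ?_, fun ζ hζ ξ hξ h ↦ ?_, fun ζ hζ ↦ ?_⟩
  · rw [harmonicExtension_coe φ ⟨ζ, hζ⟩]
    exact (φ _).2
  · rw [harmonicExtension_coe φ ⟨ζ, hζ⟩, harmonicExtension_coe φ ⟨ξ, hξ⟩] at h
    exact congrArg Subtype.val (φ.injective (Subtype.ext h))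
  · refine ⟨φ.symm ⟨ζ, hζ⟩, (φ.symm ⟨ζ, hζ⟩).2, ?_⟩
    rw [harmonicExtension_coe]
    exact congrArg Subtype.val (φ.apply_symm_apply ⟨ζ, hζ⟩)

theorem exists_homeomorph_harmonicExtension (φ : Circle ≃ₜ Circle) :
    ∃ H : closedBall (0 : ℂ) 1 ≃ₜ closedBall (0 : ℂ) 1,
      ∀ z : closedBall (0 : ℂ) 1, (H z : ℂ) = harmonicExtension φ z := by
  have hF := harmonicContOnCl_harmonicExtension φ.continuous
  have hbij := bijOn_closedBall_of_harmonicContOnCl hF (bijOn_harmonicExtension_sphere φ.toEquiv)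
  have hc : Continuous (hbij.equiv (harmonicExtension φ)) :=
    Continuous.subtype_mk (continuousOn_iff_continuous_domRestrict.1 hF.continuousOn_ball) _
  exact ⟨hc.homeoOfEquivCompactToT2, fun _ ↦ rfl⟩

/-! ### Weak and classical differentials. -/

section WeakDerivative

variable {f : ℂ → ℂ} {Ω : Set ℂ}

theorem continuous_smul_of_tsupport_subset {ψ : ℂ → ℝ} {k : ℂ → ℂ} (hΩ : IsOpen Ω)
    (hψ : Continuous ψ) (hk : ContinuousOn k Ω) (hsub : tsupport ψ ⊆ Ω) :
    Continuous fun z ↦ ψ z • k z :=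
  continuous_of_tsupport fun _ hz ↦ hψ.continuousAt.smul
    (hk.continuousAt (hΩ.mem_nhds (hsub (tsupport_smul_subset_left _ _ hz))))

theorem integrable_smul_of_tsupport_subset {ψ : ℂ → ℝ} {k : ℂ → ℂ} (hΩ : IsOpen Ω)
    (hψ : Continuous ψ) (hc : HasCompactSupport ψ) (hk : ContinuousOn k Ω)
    (hsub : tsupport ψ ⊆ Ω) : Integrable fun z ↦ ψ z • k z :=
  (continuous_smul_of_tsupport_subset hΩ hψ hk hsub).integrable_of_hasCompactSupport hc.smul_right

theorem continuousOn_fderiv_apply (hΩ : IsOpen Ω) (hf : ContDiffOn ℝ 1 f Ω) (v : ℂ) :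
    ContinuousOn (fun z ↦ fderiv ℝ f z v) Ω :=
  (hf.continuousOn_fderiv_of_isOpen hΩ le_rfl).clm_apply continuousOn_const

/-- Integration by parts; each product with a test function, extended by zero, is continuous with
compact support in the plane. -/
theorem hasWeakFDerivOn_fderiv (hΩ : IsOpen Ω) (hf : ContDiffOn ℝ 1 f Ω) :
    HasWeakFDerivOn f (fderiv ℝ f) Ω := by
  intro ψ hψ hc hsub v
  have hdψ : Continuous fun z ↦ fderiv ℝ ψ z v :=
    (hψ.continuous_fderiv (by simp)).clm_apply continuous_const
  have hcd : HasCompactSupport fun z ↦ fderiv ℝ ψ z v := hc.fderiv_apply (𝕜 := ℝ) v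
  have hsubd : tsupport (fun z ↦ fderiv ℝ ψ z v) ⊆ Ω :=
    (tsupport_fderiv_apply_subset ℝ v).trans hsub
  have key := integral_smul_fderiv_eq_neg_fderiv_smul_of_integrable (μ := volume) (f := ψ)
    (g := f) (v := v)
    (integrable_smul_of_tsupport_subset hΩ hdψ hcd hf.continuousOn hsubd)
    (integrable_smul_of_tsupport_subset hΩ hψ.continuous hc (continuousOn_fderiv_apply hΩ hf v)
      hsub)
    (integrable_smul_of_tsupport_subset hΩ hψ.continuous hc hf.continuousOn hsub)
    (fun z _ ↦ (hψ.differentiable (by simp)).differentiableAt)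
    (fun z hz ↦ (hf.contDiffAt (hΩ.mem_nhds (hsub hz))).differentiableAt one_ne_zero)
  rw [setIntegral_eq_integral_of_forall_compl_eq_zero, setIntegral_eq_integral_of_forall_compl_eq_zero,
    key, neg_neg]
  · intro z hz
    rw [image_eq_zero_of_notMem_tsupport (fun h ↦ hz (hsub h)), zero_smul]
  · intro z hz
    rw [image_eq_zero_of_notMem_tsupport (f := fun z ↦ fderiv ℝ ψ z v)
      (fun h ↦ hz (hsubd h)), zero_smul]

theorem ae_eq_of_forall_integral_smul_eq {a b : ℂ → ℂ} (hΩ : IsOpen Ω)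
    (ha : IntegrableOn a Ω) (hb : ContinuousOn b Ω)
    (h : ∀ ψ : ℂ → ℝ, ContDiff ℝ (⊤ : ℕ∞) ψ → HasCompactSupport ψ → tsupport ψ ⊆ Ω →
      ∫ z in Ω, ψ z • a z = ∫ z in Ω, ψ z • b z) :
    ∀ᵐ z ∂volume.restrict Ω, a z = b z := by
  have hloc : LocallyIntegrableOn (fun z ↦ a z - b z) Ω :=
    ha.locallyIntegrableOn.sub (hb.locallyIntegrableOn hΩ.measurableSet)
  have key := hΩ.ae_eq_zero_of_integral_contDiff_smul_eq_zero hloc fun ψ hψ hc hsub ↦ by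
    have i1 : IntegrableOn (fun z ↦ ψ z • a z) Ω := by
      obtain ⟨C, hC⟩ := hc.exists_bound_of_continuous hψ.continuous
      exact Integrable.bdd_smul (C := C) ha hψ.continuous.aestronglyMeasurable
        (ae_of_all _ hC)
    have i2 : IntegrableOn (fun z ↦ ψ z • b z) Ω :=
      (integrable_smul_of_tsupport_subset hΩ hψ.continuous hc hb hsub).integrableOn
    rw [← setIntegral_eq_integral_of_forall_compl_eq_zero (s := Ω)]
    · simp_rw [smul_sub]
      rw [integral_sub i1 i2, h ψ hψ hc hsub, sub_self]
    · intro z hz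
      rw [image_eq_zero_of_notMem_tsupport (fun h ↦ hz (hsub h)), zero_smul]
  rw [ae_restrict_iff' hΩ.measurableSet]
  filter_upwards [key] with z hz hzΩ
  exact sub_eq_zero.1 (hz hzΩ)

theorem clm_ext_one_I {S T : ℂ →L[ℝ] ℂ} (h1 : S 1 = T 1) (hI : S Complex.I = T Complex.I) :
    S = T := by
  ext z
  have hz : z = z.re • (1 : ℂ) + z.im • Complex.I := by
    rw [Complex.real_smul, Complex.real_smul, mul_one, Complex.re_add_im]
  rw [hz, map_add, map_add, map_smul, map_smul, map_smul, map_smul, h1, hI]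

/-- Uniqueness of weak derivatives. The finite volume of `Ω` makes an `L^p` differential integrable;
equality almost everywhere is tested on the real basis `1, I`. -/
theorem memW1p_iff_memLp_fderiv {p : ENNReal} (hp : 1 ≤ p) (hΩ : IsOpen Ω)
    (hvol : volume Ω ≠ ⊤) (hf : ContDiffOn ℝ 1 f Ω) (hfp : MemLp f p (volume.restrict Ω)) :
    MemW1p p f Ω ↔ MemLp (fderiv ℝ f) p (volume.restrict Ω) := by
  have hweak := hasWeakFDerivOn_fderiv hΩ hf
  refine ⟨fun ⟨_, g, hg, hgw⟩ ↦ ?_, fun h ↦ ⟨hfp, _, h, hweak⟩⟩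
  have : IsFiniteMeasure (volume.restrict Ω) := ⟨by simpa using hvol.lt_top⟩
  have key (v : ℂ) : ∀ᵐ z ∂volume.restrict Ω, g z v = fderiv ℝ f z v := by
    refine ae_eq_of_forall_integral_smul_eq hΩ ?_ (continuousOn_fderiv_apply hΩ hf v)
      fun ψ hψ hc hsub ↦ ?_
    · exact (ContinuousLinearMap.apply ℝ ℂ v).integrable_comp (hg.integrable hp)
    · exact neg_injective ((hgw ψ hψ hc hsub v).symm.trans (hweak ψ hψ hc hsub v))
  refine (memLp_congr_ae ?_).1 hg
  filter_upwards [key 1, key Complex.I] with z h1 hI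
  exact clm_ext_one_I h1 hI

end WeakDerivative

theorem contDiffOn_harmonicExtension {φ : Circle → Circle} (hφ : Continuous φ) :
    ContDiffOn ℝ 1 (harmonicExtension φ) (ball 0 1) :=
  (harmonicOnNhd_harmonicExtension hφ).contDiffOn.of_le one_le_two

theorem memW1p_harmonicExtension_iff (φ : Circle ≃ₜ Circle) {p : ℝ} (hp : 1 < p) :
    MemW1p (ENNReal.ofReal p) (harmonicExtension φ) (ball (0 : ℂ) 1) ↔
      ∫⁻ z in ball (0 : ℂ) 1, ‖fderiv ℝ (harmonicExtension φ) z‖ₑ ^ p < ⊤ := by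
  have hF := harmonicContOnCl_harmonicExtension φ.continuous
  have hbij := bijOn_harmonicExtension_sphere φ.toEquiv
  have hball := mapsTo_ball_of_harmonicContOnCl hF hbij.mapsTo hbij.injOn
  have hC := contDiffOn_harmonicExtension φ.continuous
  have hvol : volume (ball (0 : ℂ) 1) ≠ ⊤ := measure_ball_lt_top.ne
  have : IsFiniteMeasure (volume.restrict (ball (0 : ℂ) 1)) := ⟨by simp⟩
  have hmem : MemLp (harmonicExtension φ) (ENNReal.ofReal p)
      (volume.restrict (ball (0 : ℂ) 1)) := by
    refine MemLp.of_bound (hC.continuousOn.aestronglyMeasurable measurableSet_ball) 1 ?_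
    rw [ae_restrict_iff' measurableSet_ball]
    refine ae_of_all _ fun z hz ↦ ?_
    have := hball hz
    exact (mem_ball_zero_iff.1 this).le
  rw [memW1p_iff_memLp_fderiv (by simpa using hp.le) isOpen_ball hvol hC hmem]
  have hmeas : AEStronglyMeasurable (fderiv ℝ (harmonicExtension φ))
      (volume.restrict (ball (0 : ℂ) 1)) :=
    (hC.continuousOn_fderiv_of_isOpen isOpen_ball le_rfl).aestronglyMeasurable measurableSet_ball
  have hp0 : ENNReal.ofReal p ≠ 0 := by simp; linarith
  rw [MemLp, and_iff_right hmeas, eLpNorm_lt_top_iff_lintegral_rpow_enorm_lt_top hp0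
    ENNReal.ofReal_ne_top, ENNReal.toReal_ofReal (by linarith)]

/-! ### Schur's test and a Hardy–Hilbert inequality. -/

/-- **Schur test** for integral operators with nonnegative kernel. -/
theorem lintegral_schur_test {X Y : Type*} [MeasurableSpace X] [MeasurableSpace Y]
    {μ : Measure X} {ν : Measure Y} [SFinite μ] [SFinite ν] {p q : ℝ} (hpq : p.HolderConjugate q)
    {K : X → Y → ENNReal} (hK : Measurable (Function.uncurry K))
    {k : X → ENNReal} {h : Y → ENNReal} (hk : Measurable k) (hh : Measurable h)
    (h0 : ∀ᵐ y ∂ν, h y ≠ 0 ∧ h y ≠ ⊤) {A B : ENNReal}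
    (h1 : ∀ᵐ x ∂μ, ∫⁻ y, K x y * h y ^ q ∂ν ≤ A * k x ^ q)
    (h2 : ∀ᵐ y ∂ν, ∫⁻ x, K x y * k x ^ p ∂μ ≤ B * h y ^ p)
    {f : Y → ENNReal} (hf : Measurable f) :
    ∫⁻ x, (∫⁻ y, K x y * f y ∂ν) ^ p ∂μ ≤ A ^ (p / q) * B * ∫⁻ y, f y ^ p ∂ν := by
  have hp := hpq.pos
  have hq := hpq.symm.pos
  have hKx (x : X) : Measurable (K x) := hK.of_uncurry_left
  have pointwise : ∀ᵐ x ∂μ, (∫⁻ y, K x y * f y ∂ν) ^ p ≤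
      A ^ (p / q) * ∫⁻ y, k x ^ p * (K x y * (f y / h y) ^ p) ∂ν := by
    filter_upwards [h1] with x hx
    -- Split `K f = (K^{1/p} f / h) (K^{1/q} h)` for Hölder; `h1` bounds the second factor, and
    -- after Tonelli `h2` bounds the first.
    have e : ∫⁻ y, K x y * f y ∂ν =
        ∫⁻ y, ((fun y ↦ K x y ^ (1 / p) * (f y / h y)) * (fun y ↦ K x y ^ (1 / q) * h y)) y ∂ν := by
      refine lintegral_congr_ae ?_
      filter_upwards [h0] with y hy
      simp only [Pi.mul_apply]
      calc K x y * f y = K x y ^ (1 / p + 1 / q) * (f y / h y * h y) := by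
            rw [ENNReal.div_mul_cancel hy.1 hy.2, one_div, one_div, hpq.inv_add_inv_eq_one,
              ENNReal.rpow_one]
        _ = _ := by
            rw [ENNReal.rpow_add_of_nonneg _ _ (by positivity) (by positivity)]
            ring
    have hold := ENNReal.lintegral_mul_le_Lp_mul_Lq ν hpq
      (f := fun y ↦ K x y ^ (1 / p) * (f y / h y)) (g := fun y ↦ K x y ^ (1 / q) * h y)
      (by fun_prop) (by fun_prop)
    rw [e]
    calc _ ≤ ((∫⁻ y, (K x y ^ (1 / p) * (f y / h y)) ^ p ∂ν) ^ (1 / p) *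
          (∫⁻ y, (K x y ^ (1 / q) * h y) ^ q ∂ν) ^ (1 / q)) ^ p := by gcongr
      _ = (∫⁻ y, K x y * (f y / h y) ^ p ∂ν) * (∫⁻ y, K x y * h y ^ q ∂ν) ^ (p / q) := by
          rw [ENNReal.mul_rpow_of_nonneg _ _ hp.le, ← ENNReal.rpow_mul, ← ENNReal.rpow_mul,
            one_div_mul_cancel hp.ne', ENNReal.rpow_one, one_div_mul_eq_div]
          simp_rw [ENNReal.mul_rpow_of_nonneg _ _ hp.le, ENNReal.mul_rpow_of_nonneg _ _ hq.le,
            ← ENNReal.rpow_mul, one_div_mul_cancel hp.ne', one_div_mul_cancel hq.ne',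
            ENNReal.rpow_one]
      _ ≤ (∫⁻ y, K x y * (f y / h y) ^ p ∂ν) * (A * k x ^ q) ^ (p / q) := by gcongr
      _ = _ := by
          rw [ENNReal.mul_rpow_of_nonneg _ _ (by positivity), ← ENNReal.rpow_mul,
            mul_div_cancel₀ _ hq.ne', lintegral_const_mul _ (by fun_prop)]
          ring
  calc ∫⁻ x, (∫⁻ y, K x y * f y ∂ν) ^ p ∂μ
      ≤ ∫⁻ x, A ^ (p / q) * ∫⁻ y, k x ^ p * (K x y * (f y / h y) ^ p) ∂ν ∂μ :=
        lintegral_mono_ae pointwise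
    _ = A ^ (p / q) * ∫⁻ x, ∫⁻ y, k x ^ p * (K x y * (f y / h y) ^ p) ∂ν ∂μ := by
        refine lintegral_const_mul _ (Measurable.lintegral_prod_right' (f := fun z : X × Y ↦
          k z.1 ^ p * (Function.uncurry K z * (f z.2 / h z.2) ^ p)) ?_)
        fun_prop
    _ = A ^ (p / q) * ∫⁻ y, ∫⁻ x, k x ^ p * (K x y * (f y / h y) ^ p) ∂μ ∂ν := by
        rw [lintegral_lintegral_swap]
        exact Measurable.aemeasurable (f := fun z : X × Y ↦
          k z.1 ^ p * (Function.uncurry K z * (f z.2 / h z.2) ^ p)) (by fun_prop)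
    _ ≤ A ^ (p / q) * ∫⁻ y, B * f y ^ p ∂ν := by
        gcongr _ * ?_
        refine lintegral_mono_ae ?_
        filter_upwards [h0, h2] with y hy hy2
        have hKy : Measurable fun x ↦ K x y := hK.of_uncurry_right
        calc ∫⁻ x, k x ^ p * (K x y * (f y / h y) ^ p) ∂μ
            = ∫⁻ x, (f y / h y) ^ p * (K x y * k x ^ p) ∂μ := by
              refine lintegral_congr fun x ↦ ?_
              ring
          _ = (f y / h y) ^ p * ∫⁻ x, K x y * k x ^ p ∂μ := lintegral_const_mul _ (by fun_prop)
          _ ≤ (f y / h y) ^ p * (B * h y ^ p) := by gcongr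
          _ = B * (f y / h y * h y) ^ p := by
              rw [ENNReal.mul_rpow_of_nonneg _ _ hp.le]; ring
          _ = B * f y ^ p := by rw [ENNReal.div_mul_cancel hy.1 hy.2]
    _ = A ^ (p / q) * B * ∫⁻ y, f y ^ p ∂ν := by
        rw [lintegral_const_mul _ (by fun_prop), mul_assoc]

theorem lintegral_Ioc_rpow_neg {s x : ℝ} (hs : s < 1) (hx : 0 < x) :
    ∫⁻ y in Ioc 0 x, ENNReal.ofReal (y ^ (-s)) = ENNReal.ofReal (x ^ (1 - s) / (1 - s)) := by
  have hint : IntegrableOn (fun y : ℝ ↦ y ^ (-s)) (Ioc 0 x) :=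
    (intervalIntegrable_iff_integrableOn_Ioc_of_le hx.le).1
      (intervalIntegral.intervalIntegrable_rpow' (by linarith))
  rw [← ofReal_integral_eq_lintegral_ofReal hint, ← intervalIntegral.integral_of_le hx.le,
    integral_rpow (Or.inl (by linarith))]
  · rw [Real.zero_rpow (by linarith), sub_zero, neg_add_eq_sub]
  · rw [EventuallyLE, ae_restrict_iff' measurableSet_Ioc]
    exact ae_of_all _ fun y hy ↦ Real.rpow_nonneg hy.1.le _

theorem lintegral_Ioi_rpow_neg {s x : ℝ} (hs : 0 < s) (hx : 0 < x) :
    ∫⁻ y in Ioi x, ENNReal.ofReal (y ^ (-1 - s)) = ENNReal.ofReal (x ^ (-s) / s) := by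
  have hint : IntegrableOn (fun y : ℝ ↦ y ^ (-1 - s)) (Ioi x) :=
    integrableOn_Ioi_rpow_of_lt (by linarith) hx
  rw [← ofReal_integral_eq_lintegral_ofReal hint, integral_Ioi_rpow_of_lt (by linarith) hx]
  · congr 1
    rw [show -1 - s + 1 = -s by ring, neg_div_neg_eq]
  · rw [EventuallyLE, ae_restrict_iff' measurableSet_Ioi]
    exact ae_of_all _ fun y hy ↦ Real.rpow_nonneg (hx.trans hy).le _

/-- Powers are eigenfunctions because the kernel is homogeneous of degree `-1`; the integrals over
`y ≤ x` and `y > x` give the two terms of the eigenvalue. -/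
theorem lintegral_inv_max_mul_rpow_neg {s x : ℝ} (hs0 : 0 < s) (hs1 : s < 1) (hx : 0 < x) :
    ∫⁻ y in Ioi 0, ENNReal.ofReal (max x y)⁻¹ * ENNReal.ofReal (y ^ (-s)) =
      ENNReal.ofReal (1 / (1 - s) + 1 / s) * ENNReal.ofReal (x ^ (-s)) := by
  have hpos : 0 < 1 - s := by linarith
  rw [← Ioc_union_Ioi_eq_Ioi hx.le, lintegral_union measurableSet_Ioi (Ioc_disjoint_Ioi le_rfl)]
  have e1 : ∫⁻ y in Ioc 0 x, ENNReal.ofReal (max x y)⁻¹ * ENNReal.ofReal (y ^ (-s)) =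
      ∫⁻ y in Ioc 0 x, ENNReal.ofReal x⁻¹ * ENNReal.ofReal (y ^ (-s)) :=
    setLIntegral_congr_fun measurableSet_Ioc fun y hy ↦ by simp only [max_eq_left hy.2]
  have e2 : ∫⁻ y in Ioi x, ENNReal.ofReal (max x y)⁻¹ * ENNReal.ofReal (y ^ (-s)) =
      ∫⁻ y in Ioi x, ENNReal.ofReal (y ^ (-1 - s)) :=
    setLIntegral_congr_fun measurableSet_Ioi fun y (hy : x < y) ↦ by
      have hy0 := hx.trans hy
      simp only [max_eq_right hy.le]
      rw [← ENNReal.ofReal_mul (by positivity), ← Real.rpow_neg_one y, ← Real.rpow_add hy0,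
        sub_eq_add_neg]
  rw [e1, e2, lintegral_const_mul _ (by fun_prop), lintegral_Ioc_rpow_neg hs1 hx,
    lintegral_Ioi_rpow_neg hs0 hx, ← ENNReal.ofReal_mul (by positivity),
    ← ENNReal.ofReal_add (by positivity) (by positivity),
    ← ENNReal.ofReal_mul (by positivity)]
  congr 1
  rw [sub_eq_add_neg, Real.rpow_add hx, Real.rpow_one]
  field_simp

/-- A **Hardy–Hilbert inequality** for the kernel `1 / max x y`. -/
theorem exists_lintegral_inv_max_le {p : ℝ} (hp : 1 < p) :
    ∃ C : ENNReal, C ≠ ⊤ ∧ ∀ f : ℝ → ENNReal, Measurable f →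
      ∫⁻ x in Ioi 0, (∫⁻ y in Ioi 0, ENNReal.ofReal (max x y)⁻¹ * f y) ^ p ≤
        C * ∫⁻ y in Ioi 0, f y ^ p := by
  obtain ⟨q, hpq⟩ : ∃ q, p.HolderConjugate q := ⟨_, Real.HolderConjugate.conjExponent hp⟩
  have hp0 := hpq.pos
  have hq0 := hpq.symm.pos
  have hq1 := hpq.symm.lt
  have hpinv : p⁻¹ < 1 := inv_lt_one_of_one_lt₀ hp
  have hqinv : q⁻¹ < 1 := inv_lt_one_of_one_lt₀ hq1
  -- With this exponent `h ^ q` and `h ^ p` are `y ^ (-1/p)` and `y ^ (-1/q)`, both in the range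
  -- where powers are eigenfunctions.
  let h : ℝ → ENNReal := fun y ↦ ENNReal.ofReal (y ^ (-(p⁻¹ * q⁻¹)))
  have hq' (y : ℝ) (hy : 0 < y) : h y ^ q = ENNReal.ofReal (y ^ (-p⁻¹)) := by
    rw [ENNReal.ofReal_rpow_of_nonneg (by positivity) hq0.le, ← Real.rpow_mul hy.le]
    congr 2; field_simp
  have hp' (y : ℝ) (hy : 0 < y) : h y ^ p = ENNReal.ofReal (y ^ (-q⁻¹)) := by
    rw [ENNReal.ofReal_rpow_of_nonneg (by positivity) hp0.le, ← Real.rpow_mul hy.le]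
    congr 2; field_simp
  refine ⟨ENNReal.ofReal (1 / (1 - p⁻¹) + 1 / p⁻¹) ^ (p / q) *
    ENNReal.ofReal (1 / (1 - q⁻¹) + 1 / q⁻¹), ?_, fun f hf ↦ ?_⟩
  · exact ENNReal.mul_ne_top (ENNReal.rpow_ne_top_of_nonneg (by positivity) ENNReal.ofReal_ne_top)
      ENNReal.ofReal_ne_top
  · have hmeas : Measurable h := by fun_prop
    refine lintegral_schur_test hpq (k := h) (h := h)
      (K := fun x y : ℝ ↦ ENNReal.ofReal (max x y)⁻¹) (by fun_prop) hmeas hmeas ?_ ?_ ?_ hf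
    · rw [ae_restrict_iff' measurableSet_Ioi]
      refine ae_of_all _ fun y (hy : 0 < y) ↦ ⟨?_, ENNReal.ofReal_ne_top⟩
      have := Real.rpow_pos_of_pos hy (-(p⁻¹ * q⁻¹))
      simpa [h] using this
    · rw [ae_restrict_iff' measurableSet_Ioi]
      refine ae_of_all _ fun x (hx : 0 < x) ↦ ?_
      rw [hq' x hx, ← lintegral_inv_max_mul_rpow_neg (inv_pos.2 hp0) hpinv hx]
      exact (setLIntegral_congr_fun measurableSet_Ioi fun y hy ↦ by simp only [hq' y hy]).le
    · rw [ae_restrict_iff' measurableSet_Ioi]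
      refine ae_of_all _ fun x (hx : 0 < x) ↦ ?_
      rw [hp' x hx, ← lintegral_inv_max_mul_rpow_neg (inv_pos.2 hq0) hqinv hx]
      exact (setLIntegral_congr_fun measurableSet_Ioi fun y hy ↦ by
        simp only [hp' y hy, max_comm x y]).le

/-! ### Arc energies, the Douglas integral and polar coordinates. -/

theorem setLIntegral_Ioc_eq_of_periodic {g : ℝ → ENNReal} {T : ℝ} (hT : 0 < T)
    (hg : Function.Periodic g T) (a b : ℝ) :
    ∫⁻ x in Ioc a (a + T), g x = ∫⁻ x in Ioc b (b + T), g x := by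
  have h1 := isAddFundamentalDomain_Ioc hT a
  have h2 := isAddFundamentalDomain_Ioc hT b
  exact h1.setLIntegral_eq h2 g hg.map_vadd_zmultiples

theorem setLIntegral_comp_add_right (g : ℝ → ENNReal) (s : Set ℝ) (u : ℝ) :
    ∫⁻ x in (· + u) ⁻¹' s, g (x + u) = ∫⁻ x in s, g x :=
  (measurePreserving_add_right volume u).setLIntegral_comp_preimage_emb
    (measurableEmbedding_addRight u) g s

theorem setLIntegral_comp_neg (g : ℝ → ENNReal) (s : Set ℝ) :
    ∫⁻ x in Neg.neg ⁻¹' s, g (-x) = ∫⁻ x in s, g x :=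
  (Measure.measurePreserving_neg volume).setLIntegral_comp_preimage_emb
    (MeasurableEquiv.neg ℝ).measurableEmbedding g s

theorem setLIntegral_Ioc_comp_add_of_periodic {g : ℝ → ENNReal} {T : ℝ} (hT : 0 < T)
    (hg : Function.Periodic g T) (a b u : ℝ) :
    ∫⁻ x in Ioc a (a + T), g (x + u) = ∫⁻ x in Ioc b (b + T), g x := by
  rw [← setLIntegral_Ioc_eq_of_periodic hT hg (a + u) b,
    ← setLIntegral_comp_add_right g (Ioc (a + u) (a + u + T)) u, preimage_add_const_Ioc]
  congr 3 <;> ring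

/-- Splitting a period symmetrically about `0`. -/
theorem setLIntegral_Ioc_two_pi_eq_add {g : ℝ → ENNReal}
    (hg : Function.Periodic g (2 * Real.pi)) (hm : Measurable g) (s : ℝ) :
    ∫⁻ t in Ioc 0 (2 * Real.pi), g t = ∫⁻ τ in Ioo 0 Real.pi, (g (s + τ) + g (s - τ)) := by
  have hpi := Real.pi_pos
  have h1 := setLIntegral_Ioc_comp_add_of_periodic (by positivity) hg (-Real.pi) 0 s
  rw [zero_add, show -Real.pi + 2 * Real.pi = Real.pi by ring] at h1
  rw [← h1, ← Ioc_union_Ioc_eq_Ioc (show -Real.pi ≤ 0 by linarith) hpi.le,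
    lintegral_union measurableSet_Ioc (Ioc_disjoint_Ioc_of_le le_rfl),
    lintegral_add_left (by fun_prop), add_comm]
  congr 1
  · rw [restrict_Ioo_eq_restrict_Ioc]
    simp_rw [add_comm s]
  · rw [← setLIntegral_comp_neg (fun x ↦ g (x + s)), neg_preimage, neg_Ioc, neg_zero, neg_neg,
      ← restrict_Ioo_eq_restrict_Ico]
    simp_rw [sub_eq_add_neg, add_comm s]

theorem norm_circleExp_sub_circleExp_add (s τ : ℝ) :
    ‖(Circle.exp s : ℂ) - Circle.exp (s + τ)‖ = 2 * |Real.sin (τ / 2)| := by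
  have h1 : (Circle.exp s : ℂ) - Circle.exp (s + τ) =
      -(Circle.exp s * (Complex.exp (Complex.I * τ) - 1)) := by
    rw [Circle.exp_add, Circle.coe_mul, Circle.coe_exp τ, mul_comm Complex.I]; ring
  rw [h1, norm_neg, norm_mul, Circle.norm_coe, one_mul, Complex.norm_exp_I_mul_ofReal_sub_one,
    norm_mul, Real.norm_eq_abs, Real.norm_eq_abs, abs_two]

theorem norm_circleExp_sub_circleExp_add_le (s τ : ℝ) :
    ‖(Circle.exp s : ℂ) - Circle.exp (s + τ)‖ ≤ |τ| := by
  rw [norm_circleExp_sub_circleExp_add]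
  have := Real.abs_sin_le_abs (x := τ / 2)
  rw [abs_div, abs_two] at this
  linarith

theorem le_norm_circleExp_sub_circleExp_add (s : ℝ) {τ : ℝ} (hτ : |τ| ≤ Real.pi) :
    2 / Real.pi * |τ| ≤ ‖(Circle.exp s : ℂ) - Circle.exp (s + τ)‖ := by
  rw [norm_circleExp_sub_circleExp_add]
  have := Real.mul_abs_le_abs_sin (x := τ / 2) (by rw [abs_div, abs_two]; linarith)
  rw [abs_div, abs_two] at this
  linarith

/-- The `L^p` energy of the difference quotients of a circle map over arcs of length `τ`. -/
noncomputable def arcEnergy (p : ℝ) (φ : Circle → Circle) (τ : ℝ) : ENNReal :=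
  ∫⁻ s in Ioc 0 (2 * Real.pi), ‖((φ (Circle.exp s) : ℂ) - φ (Circle.exp (s + τ))) /
    ((Circle.exp s : ℂ) - Circle.exp (s + τ))‖ₑ ^ p

/-- Translating `s` by `τ` interchanges the end points of the arc. -/
theorem arcEnergy_neg (p : ℝ) (φ : Circle → Circle) (τ : ℝ) :
    arcEnergy p φ (-τ) = arcEnergy p φ τ := by
  have h := setLIntegral_Ioc_comp_add_of_periodic (T := 2 * Real.pi) (by positivity)
    (g := fun s ↦ ‖((φ (Circle.exp s) : ℂ) - φ (Circle.exp (s + -τ))) /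
    ((Circle.exp s : ℂ) - Circle.exp (s + -τ))‖ₑ ^ p) (fun s ↦ by
      simp only [add_right_comm s (2 * Real.pi), Circle.periodic_exp _]) 0 0 τ
  rw [zero_add] at h
  rw [arcEnergy, arcEnergy, ← h]
  refine lintegral_congr fun s ↦ ?_
  rw [add_neg_cancel_right, ← neg_sub (φ (Circle.exp s) : ℂ), ← neg_sub (Circle.exp s : ℂ),
    neg_div_neg_eq]

/-- Writing `t = s ± τ` and using that the arc energy is even, the Douglas integral is twice the
integral on the right. -/
theorem douglasCondition_iff {φ : Circle → Circle} (hφ : Continuous φ) (p : ℝ) (hp : 0 ≤ p) :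
    DouglasCondition p φ ↔ ∫⁻ τ in Ioo 0 Real.pi, arcEnergy p φ τ < ⊤ := by
  let d : ℝ → ℝ → ENNReal := fun s t ↦ ‖((φ (Circle.exp s) : ℂ) - φ (Circle.exp t)) /
    ((Circle.exp s : ℂ) - Circle.exp t)‖ₑ ^ p
  have hd : Measurable (Function.uncurry d) := by
    have h1 : Measurable fun x : ℝ ↦ (φ (Circle.exp x) : ℂ) := by
      apply Continuous.measurable; fun_prop
    have h2 : Measurable fun x : ℝ ↦ (Circle.exp x : ℂ) := by
      apply Continuous.measurable; fun_prop
    refine Measurable.pow_const (Measurable.enorm (Measurable.div ?_ ?_)) p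
    · exact (h1.comp measurable_fst).sub (h1.comp measurable_snd)
    · exact (h2.comp measurable_fst).sub (h2.comp measurable_snd)
  have key : ∫⁻ s in Ioc 0 (2 * Real.pi), ∫⁻ t in Ioc 0 (2 * Real.pi), d s t =
      2 * ∫⁻ τ in Ioo 0 Real.pi, arcEnergy p φ τ := by
    have e1 (s : ℝ) := setLIntegral_Ioc_two_pi_eq_add (g := d s) (fun t ↦ by
      simp only [d, Circle.periodic_exp t]) hd.of_uncurry_left s
    simp_rw [e1]
    rw [lintegral_lintegral_swap]
    · rw [← lintegral_const_mul' _ _ (by simp)]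
      refine lintegral_congr fun τ ↦ ?_
      rw [lintegral_add_left (by fun_prop), two_mul (arcEnergy p φ τ)]
      congr 1
      simp_rw [sub_eq_add_neg]
      exact arcEnergy_neg p φ τ
    · fun_prop
  rw [DouglasCondition]
  simp_rw [← ENNReal.ofReal_rpow_of_nonneg (norm_nonneg _) hp, ofReal_norm]
  change ∫⁻ s in Ioc 0 (2 * Real.pi), ∫⁻ t in Ioc 0 (2 * Real.pi), d s t < ⊤ ↔ _
  rw [key, ENNReal.mul_lt_top_iff]
  simp +contextual [lt_top_iff_ne_top]

/-- Polar coordinates in the unit disk, in terms of the distance to the boundary. -/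
theorem lintegral_ball_eq_polar {G : ℂ → ENNReal} (hG : Measurable G) :
    ∫⁻ z in ball (0 : ℂ) 1, G z = ∫⁻ ε in Ioo (0 : ℝ) 1, ENNReal.ofReal (1 - ε) *
      ∫⁻ θ in Ioc 0 (2 * Real.pi), G ((1 - ε : ℝ) * Circle.exp θ) := by
  have hpi := Real.pi_pos
  let A : ℝ → ENNReal := fun r ↦ ENNReal.ofReal r *
    ∫⁻ θ in Ioc 0 (2 * Real.pi), G (r * Circle.exp θ)
  have hmeas : Measurable fun q : ℝ × ℝ ↦ G (q.1 * Circle.exp q.2) :=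
    hG.comp (Continuous.measurable (by fun_prop))
  have h1 : ∫⁻ z in ball (0 : ℂ) 1, G z = ∫⁻ r in Ioo (0 : ℝ) 1, A r := by
    rw [← lintegral_indicator measurableSet_ball, ← Complex.lintegral_comp_polarCoord_symm,
      polarCoord_target, Measure.volume_eq_prod, ← Measure.prod_restrict, lintegral_prod]
    · rw [← lintegral_indicator measurableSet_Ioi, ← lintegral_indicator measurableSet_Ioo]
      refine lintegral_congr fun r ↦ ?_
      by_cases hr0 : 0 < r
      · by_cases hr1 : r < 1
        · rw [indicator_of_mem (mem_Ioi.2 hr0), indicator_of_mem (mem_Ioo.2 ⟨hr0, hr1⟩)]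
          have hper := setLIntegral_Ioc_eq_of_periodic (T := 2 * Real.pi) (by positivity)
            (g := fun θ ↦ G (r * Circle.exp θ)) (fun θ ↦ by
              simp only [Circle.periodic_exp θ]) 0 (-Real.pi)
          rw [zero_add, show -Real.pi + 2 * Real.pi = Real.pi by ring] at hper
          simp only [A]
          rw [hper, ← restrict_Ioo_eq_restrict_Ioc,
            ← lintegral_const_mul _ (show Measurable fun θ : ℝ ↦ G (r * Circle.exp θ) from
              hmeas.comp measurable_prodMk_left)]
          refine lintegral_congr fun θ ↦ ?_
          have hz : Complex.polarCoord.symm (r, θ) = r * Circle.exp θ := by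
            simp [Complex.polarCoord_symm_apply, Complex.exp_mul_I]
          rw [hz, indicator_of_mem, smul_eq_mul]
          simp [abs_of_pos hr0, hr1]
        · rw [indicator_of_mem (mem_Ioi.2 hr0), indicator_of_notMem (fun h ↦ hr1 h.2)]
          rw [lintegral_eq_zero_of_ae_eq_zero]
          refine ae_of_all _ fun θ ↦ ?_
          have hz : Complex.polarCoord.symm (r, θ) ∉ ball (0 : ℂ) 1 := by
            simp [abs_of_pos hr0, not_lt.1 hr1]
          change ENNReal.ofReal r * (ball 0 1).indicator G _ = 0
          rw [indicator_of_notMem hz, mul_zero]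
      · rw [indicator_of_notMem (show r ∉ Ioi 0 from hr0),
          indicator_of_notMem (show r ∉ Ioo 0 1 from fun h ↦ hr0 h.1)]
    · refine Measurable.aemeasurable (Measurable.mul
        (f := fun x : ℝ × ℝ ↦ ENNReal.ofReal x.1) (by fun_prop) ?_)
      have hpc : Measurable fun q : ℝ × ℝ ↦ Complex.polarCoord.symm q := by
        simp only [Complex.polarCoord_symm_apply]
        fun_prop
      exact (hG.indicator measurableSet_ball).comp hpc
  rw [h1]
  -- Substitution `r = 1 - ε`.
  have h2 := (Measure.measurePreserving_sub_left volume (1 : ℝ)).setLIntegral_comp_preimage_emb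
    (MeasurableEquiv.subLeft (1 : ℝ)).measurableEmbedding A (Ioo 0 1)
  rw [← h2, preimage_const_sub_Ioo, sub_self, sub_zero]

theorem measurable_norm_fderiv_rpow (f : ℂ → ℂ) (p : ℝ) :
    Measurable fun z ↦ ‖fderiv ℝ f z‖ₑ ^ p :=
  (measurable_fderiv ℝ f).enorm.pow_const p

/-! ### From the Douglas condition to an `L^p` gradient. -/

theorem enorm_circleAverage_le (f : ℂ → ℂ) :
    ‖Real.circleAverage f 0 1‖ₑ ≤ ∫⁻ t in Ioc 0 (2 * Real.pi), ‖f (Circle.exp t)‖ₑ := by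
  rw [circleAverage_zero_one_eq, enorm_smul]
  calc _ ≤ 1 * ‖∫ θ in (0 : ℝ)..(2 * Real.pi), f (Circle.exp θ)‖ₑ := by
        gcongr
        rw [Real.enorm_eq_ofReal (by positivity)]
        refine ENNReal.ofReal_le_one.2 (inv_le_one_of_one_le₀ ?_)
        linarith [Real.pi_gt_three]
    _ ≤ _ := by
        rw [one_mul, intervalIntegral.integral_of_le (by positivity)]
        exact enorm_integral_le_lintegral_enorm _

/-- The gradient of a harmonic function in terms of the oscillation of its boundary values. -/
theorem enorm_fderiv_le {F : ℂ → ℂ} (hF : HarmonicContOnCl F (ball 0 1)) (c : ℂ) {z : ℂ}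
    (hz : z ∈ ball (0 : ℂ) 1) :
    ‖fderiv ℝ F z‖ₑ ≤ 4 * ∫⁻ t in Ioc 0 (2 * Real.pi),
      ‖F (Circle.exp t) - c‖ₑ * (‖(Circle.exp t : ℂ) - z‖ₑ ^ 2)⁻¹ := by
  set B := ∫⁻ t in Ioc 0 (2 * Real.pi),
      ‖F (Circle.exp t) - c‖ₑ * (‖(Circle.exp t : ℂ) - z‖ₑ ^ 2)⁻¹ with hB
  have hS : ContinuousOn F (sphere 0 1) := hF.continuousOn_ball.mono sphere_subset_closedBall
  have hFd : HasFDerivAt F (fderiv ℝ F z) z := (hF.differentiableAt hz).hasFDerivAt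
  -- `L (F - c)` is the real part of a Herglotz integral, whose complex derivative has kernel `2ζ /
  -- (ζ - z)²`. Taking `L` to be the real and the imaginary part turns the factor `2` into `4`.
  have key (L : ℂ →L[ℝ] ℝ) (hL : ∀ x, ‖L x‖ₑ ≤ ‖x‖ₑ) (v : ℂ) :
      ‖L (fderiv ℝ F z v)‖ₑ ≤ 2 * B * ‖v‖ₑ := by
    have hg : ContinuousOn (fun ζ ↦ L (F ζ - c)) (sphere 0 1) :=
      L.continuous.comp_continuousOn (hS.sub continuousOn_const)
    have hgi : CircleIntegrable (fun ζ ↦ (L (F ζ - c) : ℂ)) 0 1 :=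
      circleIntegrable_of_continuousOn (Complex.continuous_ofReal.comp_continuousOn hg)
    have hΦ := hasDerivAt_circleAverage_herglotzRieszKernel_smul hgi hz
    set Φ' := Real.circleAverage (fun ζ ↦ (2 * ζ / (ζ - z) ^ 2) • (L (F ζ - c) : ℂ)) 0 1
    have hu1 : HasFDerivAt (fun w ↦ L (F w - c)) (L.comp (fderiv ℝ F z)) z :=
      L.hasFDerivAt.comp z (hFd.sub_const c)
    have hu2 : HasFDerivAt (fun w ↦ L (F w - c))
        (Complex.reCLM.comp ((ContinuousLinearMap.toSpanSingleton ℂ Φ').restrictScalars ℝ)) z := by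
      refine (Complex.reCLM.hasFDerivAt.comp z
        (hΦ.hasFDerivAt.restrictScalars ℝ)).congr_of_eventuallyEq ?_
      filter_upwards [isOpen_ball.mem_nhds hz] with w hw
      rw [Function.comp_apply, Complex.reCLM_apply,
        ← circleAverage_poissonKernel_smul_eq_re hg hw]
      exact (circleAverage_poissonKernel_smul_clm hF L c hw).symm
    have huniq := congrArg (fun T ↦ T v) (hu1.unique hu2)
    have e : L (fderiv ℝ F z v) = (v * Φ').re := by simpa using huniq
    have hbound : ‖Φ'‖ₑ ≤ 2 * B := by
      refine (enorm_circleAverage_le _).trans ?_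
      rw [hB, ← lintegral_const_mul' _ _ (by simp)]
      refine lintegral_mono fun t ↦ ?_
      have hne : (Circle.exp t : ℂ) - z ≠ 0 :=
        sub_ne_zero_of_norm_one (Circle.norm_coe _) (by simpa using hz)
      rw [enorm_smul, div_eq_mul_inv, enorm_mul, enorm_inv (pow_ne_zero 2 hne), enorm_mul, enorm_pow,
        mul_comm _ ‖(L _ : ℂ)‖ₑ]
      have e1 : ‖(Circle.exp t : ℂ)‖ₑ = 1 := by rw [← ofReal_norm, Circle.norm_coe]; simp
      have e2 : ‖(2 : ℂ)‖ₑ = 2 := by rw [← ofReal_norm]; simp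
      have e3 : ‖(L (F (Circle.exp t) - c) : ℂ)‖ₑ ≤ ‖F (Circle.exp t) - c‖ₑ := by
        refine le_trans (le_of_eq ?_) (hL _)
        rw [← ofReal_norm, ← ofReal_norm, Complex.norm_real]
      rw [e1, e2, mul_one, mul_left_comm]
      gcongr
    rw [e]
    calc ‖(v * Φ').re‖ₑ ≤ ‖v * Φ'‖ₑ := by
          rw [← ofReal_norm, ← ofReal_norm]
          exact ENNReal.ofReal_le_ofReal (Complex.abs_re_le_norm _)
      _ ≤ 2 * B * ‖v‖ₑ := by
          rw [enorm_mul, mul_comm]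
          gcongr
  have hre := key Complex.reCLM fun x ↦ by
    rw [← ofReal_norm, ← ofReal_norm]
    exact ENNReal.ofReal_le_ofReal (Complex.abs_re_le_norm _)
  have him := key Complex.imCLM fun x ↦ by
    rw [← ofReal_norm, ← ofReal_norm]
    exact ENNReal.ofReal_le_ofReal (Complex.abs_im_le_norm _)
  refine ContinuousLinearMap.opENorm_le_bound _ fun v ↦ ?_
  calc ‖fderiv ℝ F z v‖ₑ
      ≤ ‖Complex.reCLM (fderiv ℝ F z v)‖ₑ + ‖Complex.imCLM (fderiv ℝ F z v)‖ₑ := by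
        rw [← ofReal_norm, ← ofReal_norm, ← ofReal_norm,
          ← ENNReal.ofReal_add (norm_nonneg _) (norm_nonneg _)]
        exact ENNReal.ofReal_le_ofReal (Complex.norm_le_abs_re_add_abs_im _)
    _ ≤ 2 * B * ‖v‖ₑ + 2 * B * ‖v‖ₑ := add_le_add (hre v) (him v)
    _ = 4 * B * ‖v‖ₑ := by ring

/-- The distance is at least `max ε |τ| / π`. Of its two factors, one keeps the maximum, for the
Hardy–Hilbert kernel, and the other is weakened to `|τ| / π`, for the difference quotient. -/
theorem enorm_sub_sq_inv_le {ε τ : ℝ} (hε0 : 0 < ε) (hε1 : ε < 1) (hτ0 : τ ≠ 0)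
    (hτ : |τ| ≤ Real.pi) (θ : ℝ) :
    (‖(Circle.exp (θ + τ) : ℂ) - (1 - ε : ℝ) * Circle.exp θ‖ₑ ^ 2)⁻¹ ≤
      ENNReal.ofReal (Real.pi ^ 2) * (ENNReal.ofReal (max ε |τ|)⁻¹ * ENNReal.ofReal |τ|⁻¹) := by
  have hpi := Real.pi_pos
  have hτ' : 0 < |τ| := abs_pos.2 hτ0
  set x := (Circle.exp (θ + τ) : ℂ) - (1 - ε : ℝ) * Circle.exp θ with hx
  have h1 : ε ≤ ‖x‖ := by
    have h := norm_sub_norm_le (Circle.exp (θ + τ) : ℂ) ((1 - ε : ℝ) * Circle.exp θ)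
    rw [norm_mul, Circle.norm_coe, Circle.norm_coe, Complex.norm_real, Real.norm_eq_abs,
      abs_of_pos (by linarith)] at h
    linarith
  have h2 : |τ| / Real.pi ≤ ‖x‖ := by
    have h := le_norm_circleExp_sub_circleExp_add θ hτ
    have e : (Circle.exp θ : ℂ) - Circle.exp (θ + τ) = ε * Circle.exp θ - x := by
      rw [hx]; push_cast; ring
    have h3 : ‖(ε : ℂ) * Circle.exp θ - x‖ ≤ ε + ‖x‖ := by
      refine (norm_sub_le _ _).trans ?_
      rw [norm_mul, Circle.norm_coe, Complex.norm_real, Real.norm_eq_abs, abs_of_pos hε0, mul_one]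
    rw [e] at h
    have h4 : 2 / Real.pi * |τ| = 2 * (|τ| / Real.pi) := by ring
    linarith
  have h3 : max ε |τ| / Real.pi ≤ ‖x‖ := by
    rw [div_le_iff₀ hpi] at h2 ⊢
    refine max_le ?_ h2
    nlinarith [Real.pi_gt_three]
  have hx0 : 0 < ‖x‖ := hε0.trans_le h1
  have hm : 0 < max ε |τ| := lt_max_of_lt_left hε0
  rw [← ofReal_norm, ← ENNReal.ofReal_pow (norm_nonneg _), ← ENNReal.ofReal_inv_of_pos (by positivity),
    ← ENNReal.ofReal_mul (by positivity), ← ENNReal.ofReal_mul (by positivity)]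
  refine ENNReal.ofReal_le_ofReal ?_
  rw [show Real.pi ^ 2 * ((max ε |τ|)⁻¹ * |τ|⁻¹) =
    ((max ε |τ| / Real.pi) * (|τ| / Real.pi))⁻¹ by field_simp]
  refine inv_anti₀ (by positivity) ?_
  rw [sq]
  gcongr

theorem circleExp_sub_circleExp_add_ne_zero {τ : ℝ} (hτ0 : τ ≠ 0) (hτ : |τ| ≤ Real.pi) (s : ℝ) :
    (Circle.exp s : ℂ) - Circle.exp (s + τ) ≠ 0 := by
  have h := le_norm_circleExp_sub_circleExp_add s hτ
  have h1 : 0 < 2 / Real.pi * |τ| := mul_pos (div_pos two_pos Real.pi_pos) (abs_pos.2 hτ0)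
  exact norm_pos_iff.1 (h1.trans_le h)

theorem enorm_mul_inv_le_enorm_div {τ : ℝ} (hτ0 : τ ≠ 0) (hτ : |τ| ≤ Real.pi) (s : ℝ) (a : ℂ) :
    ‖a‖ₑ * ENNReal.ofReal |τ|⁻¹ ≤ ‖a / ((Circle.exp s : ℂ) - Circle.exp (s + τ))‖ₑ := by
  have h0 := norm_pos_iff.2 (circleExp_sub_circleExp_add_ne_zero hτ0 hτ s)
  rw [← ofReal_norm, ← ofReal_norm, ← ENNReal.ofReal_mul (norm_nonneg _), norm_div]
  refine ENNReal.ofReal_le_ofReal ?_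
  rw [div_eq_mul_inv]
  gcongr
  exact norm_circleExp_sub_circleExp_add_le s τ

theorem enorm_div_le_mul_inv {τ : ℝ} (hτ0 : τ ≠ 0) (hτ : |τ| ≤ Real.pi) (s : ℝ) (a : ℂ) :
    ‖a / ((Circle.exp s : ℂ) - Circle.exp (s + τ))‖ₑ ≤
      ENNReal.ofReal (Real.pi / 2) * (‖a‖ₑ * ENNReal.ofReal |τ|⁻¹) := by
  have hpi := Real.pi_pos
  have hτ' : 0 < |τ| := abs_pos.2 hτ0
  rw [← ofReal_norm, ← ofReal_norm, ← ENNReal.ofReal_mul (norm_nonneg _),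
    ← ENNReal.ofReal_mul (by positivity), norm_div]
  refine ENNReal.ofReal_le_ofReal ?_
  calc ‖a‖ / ‖(Circle.exp s : ℂ) - Circle.exp (s + τ)‖ ≤ ‖a‖ / (2 / Real.pi * |τ|) := by
        gcongr
        exact le_norm_circleExp_sub_circleExp_add s hτ
    _ = _ := by field_simp

theorem exists_lintegral_Ioo_inv_max_le {p : ℝ} (hp : 1 < p) :
    ∃ C : ENNReal, C ≠ ⊤ ∧ ∀ (b : ℝ) (f : ℝ → ENNReal), Measurable f →
      ∫⁻ x in Ioi 0, (∫⁻ y in Ioo 0 b, ENNReal.ofReal (max x y)⁻¹ * f y) ^ p ≤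
        C * ∫⁻ y in Ioo 0 b, f y ^ p := by
  obtain ⟨C, hC, h⟩ := exists_lintegral_inv_max_le hp
  refine ⟨C, hC, fun b f hf ↦ ?_⟩
  have h1 (g : ℝ → ENNReal) :
      ∫⁻ y in Ioi 0, (Ioo 0 b).indicator g y = ∫⁻ y in Ioo 0 b, g y := by
    rw [setLIntegral_indicator measurableSet_Ioo,
      inter_eq_left.2 (show Ioo 0 b ⊆ Ioi 0 from fun y hy ↦ hy.1)]
  have key := h _ (hf.indicator (measurableSet_Ioo (a := 0) (b := b)))
  have e1 (x y : ℝ) : ENNReal.ofReal (max x y)⁻¹ * (Ioo 0 b).indicator f y =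
      (Ioo 0 b).indicator (fun y ↦ ENNReal.ofReal (max x y)⁻¹ * f y) y := by
    by_cases hy : y ∈ Ioo 0 b <;> simp [hy]
  have e2 (y : ℝ) : (Ioo 0 b).indicator f y ^ p = (Ioo 0 b).indicator (fun y ↦ f y ^ p) y := by
    by_cases hy : y ∈ Ioo 0 b
    · simp [hy]
    · simp [hy, zero_lt_one.trans hp]
  simp_rw [e1, e2, h1] at key
  exact key

/-- The symmetric first-order difference quotient of a circle map. -/
noncomputable def symmDiffQuot (φ : Circle → Circle) (θ τ : ℝ) : ENNReal :=
  (‖(φ (Circle.exp (θ + τ)) : ℂ) - φ (Circle.exp θ)‖ₑ +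
    ‖(φ (Circle.exp (θ - τ)) : ℂ) - φ (Circle.exp θ)‖ₑ) * ENNReal.ofReal τ⁻¹

theorem measurable_symmDiffQuot {φ : Circle → Circle} (hφ : Continuous φ) :
    Measurable (Function.uncurry (symmDiffQuot φ)) := by
  have h : Continuous fun t ↦ (φ (Circle.exp t) : ℂ) := by fun_prop
  have h1 : Continuous fun q : ℝ × ℝ ↦ (φ (Circle.exp (q.1 + q.2)) : ℂ) - φ (Circle.exp q.1) :=
    (h.comp (by fun_prop)).sub (h.comp (by fun_prop))
  have h2 : Continuous fun q : ℝ × ℝ ↦ (φ (Circle.exp (q.1 - q.2)) : ℂ) - φ (Circle.exp q.1) :=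
    (h.comp (by fun_prop)).sub (h.comp (by fun_prop))
  exact (h1.measurable.enorm.add h2.measurable.enorm).mul (by fun_prop)

theorem lintegral_symmDiffQuot_le {p : ℝ} (hp : 1 ≤ p) {φ : Circle → Circle} (hφ : Continuous φ)
    {τ : ℝ} (hτ : τ ∈ Ioo 0 Real.pi) :
    ∫⁻ θ in Ioc 0 (2 * Real.pi), symmDiffQuot φ θ τ ^ p ≤
      2 ^ (p - 1) * (arcEnergy p φ τ + arcEnergy p φ τ) := by
  have hτ0 : τ ≠ 0 := hτ.1.ne'
  have hτabs : |τ| = τ := abs_of_pos hτ.1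
  -- One copy is moved to `-τ` to match the backward difference.
  conv_rhs => enter [2, 2]; rw [← arcEnergy_neg]
  have hm : Measurable fun s ↦ ‖((φ (Circle.exp s) : ℂ) - φ (Circle.exp (s + τ))) /
      ((Circle.exp s : ℂ) - Circle.exp (s + τ))‖ₑ ^ p := by
    have h1 : Measurable fun x : ℝ ↦ (φ (Circle.exp x) : ℂ) := by
      apply Continuous.measurable; fun_prop
    have h2 : Measurable fun x : ℝ ↦ (Circle.exp x : ℂ) := by
      apply Continuous.measurable; fun_prop
    have h3 : Measurable fun x : ℝ ↦ x + τ := by fun_prop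
    exact (Measurable.div (h1.sub (h1.comp h3)) (h2.sub (h2.comp h3))).enorm.pow_const p
  rw [arcEnergy, arcEnergy, ← lintegral_add_left hm, ← lintegral_const_mul' _ _ (by simp)]
  refine lintegral_mono fun θ ↦ ?_
  rw [symmDiffQuot, add_mul]
  refine (ENNReal.rpow_add_le_mul_rpow_add_rpow _ _ hp).trans ?_
  have e1 := enorm_mul_inv_le_enorm_div hτ0 (by rw [hτabs]; exact hτ.2.le) θ
    ((φ (Circle.exp θ) : ℂ) - φ (Circle.exp (θ + τ)))
  have e2 := enorm_mul_inv_le_enorm_div (neg_ne_zero.2 hτ0) (by rw [abs_neg, hτabs]; exact hτ.2.le) θ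
    ((φ (Circle.exp θ) : ℂ) - φ (Circle.exp (θ + -τ)))
  rw [abs_neg, hτabs] at e2
  rw [hτabs] at e1
  rw [enorm_sub_rev, enorm_sub_rev (φ (Circle.exp (θ - τ)) : ℂ)]
  gcongr
  rwa [sub_eq_add_neg]

theorem enorm_fderiv_harmonicExtension_le {φ : Circle → Circle} (hφ : Continuous φ) {ε : ℝ}
    (hε : ε ∈ Ioo (0 : ℝ) 1) (θ : ℝ) :
    ‖fderiv ℝ (harmonicExtension φ) ((1 - ε : ℝ) * Circle.exp θ)‖ₑ ≤
      4 * ENNReal.ofReal (Real.pi ^ 2) *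
        ∫⁻ τ in Ioo 0 Real.pi, ENNReal.ofReal (max ε τ)⁻¹ * symmDiffQuot φ θ τ := by
  have hz : ((1 - ε : ℝ) : ℂ) * Circle.exp θ ∈ ball (0 : ℂ) 1 := by
    rw [mem_ball_zero_iff, norm_mul, Circle.norm_coe, Complex.norm_real, Real.norm_eq_abs,
      abs_of_pos (by linarith [hε.2])]
    linarith [hε.1]
  have h := enorm_fderiv_le (harmonicContOnCl_harmonicExtension hφ) (φ (Circle.exp θ)) hz
  simp_rw [harmonicExtension_coe] at h
  have hc : Continuous fun t ↦ (φ (Circle.exp t) : ℂ) := by fun_prop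
  have hc' : Continuous fun t ↦ (Circle.exp t : ℂ) := by fun_prop
  rw [setLIntegral_Ioc_two_pi_eq_add (g := fun t ↦ ‖(φ (Circle.exp t) : ℂ) - φ (Circle.exp θ)‖ₑ *
      (‖(Circle.exp t : ℂ) - (1 - ε : ℝ) * Circle.exp θ‖ₑ ^ 2)⁻¹) (s := θ)
    (fun t ↦ by simp only [Circle.periodic_exp t]) ((hc.sub continuous_const).measurable.enorm.mul
      (((hc'.sub continuous_const).measurable.enorm.pow_const 2).inv))] at h
  refine h.trans ?_
  rw [mul_assoc]
  gcongr
  rw [← lintegral_const_mul' _ _ ENNReal.ofReal_ne_top]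
  refine setLIntegral_mono' measurableSet_Ioo fun τ hτ ↦ ?_
  have hτ0 : τ ≠ 0 := hτ.1.ne'
  have hτabs : |τ| = τ := abs_of_pos hτ.1
  have k1 := enorm_sub_sq_inv_le hε.1 hε.2 hτ0 (by rw [hτabs]; exact hτ.2.le) θ
  have k2 := enorm_sub_sq_inv_le hε.1 hε.2 (neg_ne_zero.2 hτ0)
    (by rw [abs_neg, hτabs]; exact hτ.2.le) θ
  rw [abs_neg, hτabs, ← sub_eq_add_neg] at k2
  rw [hτabs] at k1
  calc _ ≤ _ := add_le_add (mul_le_mul_right k1 _) (mul_le_mul_right k2 _)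
    _ = _ := by rw [symmDiffQuot]; ring

/-- Hardy–Hilbert is applied in the depth `ε` at each fixed angle `θ`; Tonelli then restores the arc
energies. The polar Jacobian `1 - ε ≤ 1` is dropped. -/
theorem lintegral_fderiv_lt_top_of_arcEnergy {φ : Circle → Circle} (hφ : Continuous φ) {p : ℝ}
    (hp : 1 < p) (h : ∫⁻ τ in Ioo 0 Real.pi, arcEnergy p φ τ < ⊤) :
    ∫⁻ z in ball (0 : ℂ) 1, ‖fderiv ℝ (harmonicExtension φ) z‖ₑ ^ p < ⊤ := by
  obtain ⟨C, hC, hardy⟩ := exists_lintegral_Ioo_inv_max_le hp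
  have hp0 : 0 ≤ p := by linarith
  set K : ENNReal := 4 * ENNReal.ofReal (Real.pi ^ 2) with hKdef
  have hK : K ≠ ⊤ := ENNReal.mul_ne_top (by simp) ENNReal.ofReal_ne_top
  have hKp : K ^ p ≠ ⊤ := ENNReal.rpow_ne_top_of_nonneg hp0 hK
  have hq := measurable_symmDiffQuot hφ
  have hJ : Measurable fun x : ℝ × ℝ ↦
      (∫⁻ τ in Ioo 0 Real.pi, ENNReal.ofReal (max x.1 τ)⁻¹ * symmDiffQuot φ x.2 τ) ^ p := by
    refine Measurable.pow_const (Measurable.lintegral_prod_right' (f := fun y : (ℝ × ℝ) × ℝ ↦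
      ENNReal.ofReal (max y.1.1 y.2)⁻¹ * Function.uncurry (symmDiffQuot φ) (y.1.2, y.2)) ?_) p
    exact Measurable.mul (by fun_prop) (hq.comp (by fun_prop))
  rw [lintegral_ball_eq_polar (measurable_norm_fderiv_rpow _ p)]
  calc _ ≤ ∫⁻ ε in Ioo (0 : ℝ) 1, ∫⁻ θ in Ioc 0 (2 * Real.pi), K ^ p *
          (∫⁻ τ in Ioo 0 Real.pi, ENNReal.ofReal (max ε τ)⁻¹ * symmDiffQuot φ θ τ) ^ p := by
        refine setLIntegral_mono' measurableSet_Ioo fun ε hε ↦ ?_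
        refine (mul_le_of_le_one_left zero_le ?_).trans (lintegral_mono fun θ ↦ ?_)
        · exact ENNReal.ofReal_le_one.2 (by linarith [hε.1])
        · rw [← ENNReal.mul_rpow_of_nonneg _ _ hp0]
          exact ENNReal.rpow_le_rpow (enorm_fderiv_harmonicExtension_le hφ hε θ) hp0
    _ = K ^ p * ∫⁻ θ in Ioc 0 (2 * Real.pi), ∫⁻ ε in Ioo (0 : ℝ) 1,
          (∫⁻ τ in Ioo 0 Real.pi, ENNReal.ofReal (max ε τ)⁻¹ * symmDiffQuot φ θ τ) ^ p := by
        rw [← lintegral_lintegral_swap (f := fun (ε θ : ℝ) ↦ (∫⁻ τ in Ioo 0 Real.pi,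
          ENNReal.ofReal (max ε τ)⁻¹ * symmDiffQuot φ θ τ) ^ p) hJ.aemeasurable,
          ← lintegral_const_mul' _ _ hKp]
        simp_rw [lintegral_const_mul' _ _ hKp]
    _ ≤ K ^ p * ∫⁻ θ in Ioc 0 (2 * Real.pi), C * ∫⁻ τ in Ioo 0 Real.pi, symmDiffQuot φ θ τ ^ p := by
        gcongr with θ
        refine (lintegral_mono_set (fun ε hε ↦ hε.1)).trans (hardy _ _ ?_)
        exact hq.of_uncurry_left
    _ = K ^ p * (C * ∫⁻ τ in Ioo 0 Real.pi,
          ∫⁻ θ in Ioc 0 (2 * Real.pi), symmDiffQuot φ θ τ ^ p) := by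
        rw [lintegral_const_mul' _ _ hC, lintegral_lintegral_swap]
        exact (hq.pow_const p).aemeasurable
    _ ≤ K ^ p * (C * ∫⁻ τ in Ioo 0 Real.pi, 2 ^ (p - 1) * (2 * arcEnergy p φ τ)) := by
        gcongr _ * (_ * ?_)
        refine setLIntegral_mono' measurableSet_Ioo fun τ hτ ↦ ?_
        rw [two_mul (arcEnergy p φ τ)]
        exact lintegral_symmDiffQuot_le hp.le hφ hτ
    _ < ⊤ := by
        have h2 : (2 : ENNReal) ^ (p - 1) ≠ ⊤ :=
          ENNReal.rpow_ne_top_of_nonneg (by linarith) (by simp)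
        rw [lintegral_const_mul' _ _ h2, lintegral_const_mul' _ _ (by simp)]
        exact ENNReal.mul_lt_top hKp.lt_top (ENNReal.mul_lt_top hC.lt_top
          (ENNReal.mul_lt_top h2.lt_top (ENNReal.mul_lt_top (by simp) h)))

/-! ### From an `L^p` gradient to the Douglas condition. -/

theorem lintegral_rpow_le_measure_univ_mul {X : Type*} [MeasurableSpace X] {μ : Measure X} {p : ℝ}
    (hp : 1 < p) {g : X → ENNReal} (hg : Measurable g) :
    (∫⁻ x, g x ∂μ) ^ p ≤ μ univ ^ (p - 1) * ∫⁻ x, g x ^ p ∂μ := by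
  obtain ⟨q, hpq⟩ : ∃ q, p.HolderConjugate q := ⟨_, Real.HolderConjugate.conjExponent hp⟩
  have hp0 := hpq.pos
  have hold := ENNReal.lintegral_mul_le_Lp_mul_Lq μ hpq (f := g) (g := fun _ ↦ 1)
    hg.aemeasurable aemeasurable_const
  have e : ∫⁻ x, (g * (fun _ : X ↦ (1 : ENNReal))) x ∂μ = ∫⁻ x, g x ∂μ := by simp
  rw [e] at hold
  refine (ENNReal.rpow_le_rpow hold hp0.le).trans (le_of_eq ?_)
  rw [ENNReal.mul_rpow_of_nonneg _ _ hp0.le, ← ENNReal.rpow_mul, ← ENNReal.rpow_mul,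
    one_div_mul_cancel hp0.ne', ENNReal.rpow_one, one_div_mul_eq_div, hpq.div_conj_eq_sub_one,
    mul_comm]
  simp

theorem rpow_add_add_le {p : ℝ} (hp : 1 ≤ p) (x y z : ENNReal) :
    (x + (y + z)) ^ p ≤ (2 ^ (p - 1)) ^ 2 * (x ^ p + (y ^ p + z ^ p)) := by
  have h1 : (1 : ENNReal) ≤ 2 ^ (p - 1) := by
    simpa using ENNReal.rpow_le_rpow_of_exponent_le (x := 2) (by norm_num)
      (show (0 : ℝ) ≤ p - 1 by linarith)
  calc (x + (y + z)) ^ p ≤ 2 ^ (p - 1) * (x ^ p + (y + z) ^ p) :=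
        ENNReal.rpow_add_le_mul_rpow_add_rpow _ _ hp
    _ ≤ 2 ^ (p - 1) * (2 ^ (p - 1) * x ^ p + 2 ^ (p - 1) * (y ^ p + z ^ p)) := by
        gcongr
        · exact le_mul_of_one_le_left zero_le h1
        · exact ENNReal.rpow_add_le_mul_rpow_add_rpow _ _ hp
    _ = _ := by ring

theorem enorm_sub_le_lintegral_fderiv {F : ℂ → ℂ} {Ω : Set ℂ} (hΩ : IsOpen Ω)
    (hF : ContDiffOn ℝ 1 F Ω) {c : ℝ → ℂ} (hc : ContDiff ℝ 1 c) (hc1 : ∀ x, ‖deriv c x‖ ≤ 1)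
    {a b : ℝ} (hab : a ≤ b) (hmaps : MapsTo c (Icc a b) Ω) :
    ‖F (c b) - F (c a)‖ₑ ≤ ∫⁻ x in Icc a b, ‖fderiv ℝ F (c x)‖ₑ := by
  refine (enorm_sub_le_lintegral_deriv_of_contDiffOn_Icc
    (hF.comp hc.contDiffOn hmaps) hab).trans ?_
  refine setLIntegral_mono' measurableSet_Icc fun x hx ↦ ?_
  have h1 : HasFDerivAt F (fderiv ℝ F (c x)) (c x) :=
    ((hF.contDiffAt (hΩ.mem_nhds (hmaps hx))).differentiableAt one_ne_zero).hasFDerivAt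
  have h2 : HasDerivAt c (deriv c x) x := (hc.differentiable one_ne_zero x).hasDerivAt
  rw [(h1.comp_hasDerivAt x h2).deriv]
  refine (ContinuousLinearMap.le_opENorm _ _).trans (mul_le_of_le_one_right zero_le ?_)
  rw [← ofReal_norm]
  exact ENNReal.ofReal_le_one.2 (hc1 x)

theorem ofReal_mul_circleExp_mem_ball {r : ℝ} (hr0 : 0 ≤ r) (hr1 : r < 1) (s : ℝ) :
    (r : ℂ) * Circle.exp s ∈ ball (0 : ℂ) 1 := by
  rw [mem_ball_zero_iff, norm_mul, Circle.norm_coe, Complex.norm_real, Real.norm_eq_abs,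
    abs_of_nonneg hr0, mul_one]
  exact hr1

/-- The radial variation of a function in the disk, near the boundary. -/
theorem enorm_sub_le_lintegral_radial {F : ℂ → ℂ} (hF : ContDiffOn ℝ 1 F (ball 0 1))
    (hFc : ContinuousOn F (closedBall 0 1)) {τ : ℝ} (hτ : τ ∈ Ioo (0 : ℝ) 1) (s : ℝ) :
    ‖F ((1 - τ : ℝ) * Circle.exp s) - F (Circle.exp s)‖ₑ ≤
      ∫⁻ ρ in Ioo 0 τ, ‖fderiv ℝ F ((1 - ρ : ℝ) * Circle.exp s)‖ₑ := by
  have hcont : ContinuousWithinAt (fun δ : ℝ ↦ F ((1 - δ : ℝ) * Circle.exp s)) (Ioo 0 τ) 0 := by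
    have h1 : ContinuousOn (fun δ : ℝ ↦ F ((1 - δ : ℝ) * Circle.exp s)) (Icc 0 1) := by
      refine hFc.comp (Continuous.continuousOn (by fun_prop)) fun δ hδ ↦ ?_
      rw [mem_closedBall_zero_iff, norm_mul, Circle.norm_coe, Complex.norm_real, Real.norm_eq_abs,
        abs_of_nonneg (by linarith [hδ.2])]
      linarith [hδ.1]
    exact (h1 0 (by simp)).mono fun x hx ↦ ⟨hx.1.le, hx.2.le.trans hτ.2.le⟩
  have htend : Tendsto (fun δ : ℝ ↦ ‖F ((1 - τ : ℝ) * Circle.exp s) -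
      F ((1 - δ : ℝ) * Circle.exp s)‖ₑ) (𝓝[Ioo 0 τ] 0)
      (𝓝 ‖F ((1 - τ : ℝ) * Circle.exp s) - F ((1 - (0 : ℝ) : ℝ) * Circle.exp s)‖ₑ) :=
    (continuous_enorm.tendsto _).comp (tendsto_const_nhds.sub hcont)
  rw [sub_zero, Complex.ofReal_one, one_mul] at htend
  have hne : (𝓝[Ioo 0 τ] (0 : ℝ)).NeBot := left_nhdsWithin_Ioo_neBot hτ.1
  -- Differentiability is known only inside, so the path stops at depth `δ` and continuity up to the
  -- boundary gives the limit `δ → 0`.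
  refine le_of_tendsto htend ?_
  filter_upwards [self_mem_nhdsWithin] with δ hδ
  have hd (x : ℝ) : HasDerivAt (fun ρ : ℝ ↦ ((1 - ρ : ℝ) : ℂ) * Circle.exp s)
      (-(Circle.exp s : ℂ)) x := by
    have h := (((hasDerivAt_id x).const_sub 1).ofReal_comp).mul_const (Circle.exp s : ℂ)
    simpa using h
  refine (enorm_sub_le_lintegral_fderiv isOpen_ball hF
    (c := fun ρ : ℝ ↦ ((1 - ρ : ℝ) : ℂ) * Circle.exp s) ?_ (fun x ↦ ?_) hδ.2.le ?_).trans ?_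
  · exact (Complex.ofRealCLM.contDiff.comp (contDiff_const.sub contDiff_id)).mul contDiff_const
  · rw [(hd x).deriv, norm_neg, Circle.norm_coe]
  · exact fun x hx ↦ ofReal_mul_circleExp_mem_ball (by linarith [hx.2, hτ.2])
      (by linarith [hx.1, hδ.1]) s
  · rw [restrict_Ioo_eq_restrict_Ioc]
    exact lintegral_mono_set fun x hx ↦ ⟨hδ.1.trans_le hx.1, hx.2⟩

theorem enorm_sub_le_lintegral_arc {F : ℂ → ℂ} (hF : ContDiffOn ℝ 1 F (ball 0 1)) {τ : ℝ}
    (hτ : τ ∈ Ioo (0 : ℝ) 1) (s : ℝ) :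
    ‖F ((1 - τ : ℝ) * Circle.exp (s + τ)) - F ((1 - τ : ℝ) * Circle.exp s)‖ₑ ≤
      ∫⁻ u in Ioo 0 τ, ‖fderiv ℝ F ((1 - τ : ℝ) * Circle.exp (s + u))‖ₑ := by
  have hd (x : ℝ) : HasDerivAt (fun u : ℝ ↦ ((1 - τ : ℝ) : ℂ) * Circle.exp (s + u))
      (((1 - τ : ℝ) : ℂ) * (Circle.exp (s + x) * Complex.I)) x := by
    simp only [Circle.coe_exp]
    have h := ((((hasDerivAt_id x).const_add s).ofReal_comp).mul_const Complex.I).cexp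
    simpa using h.const_mul ((1 - τ : ℝ) : ℂ)
  have h := enorm_sub_le_lintegral_fderiv isOpen_ball hF
    (c := fun u : ℝ ↦ ((1 - τ : ℝ) : ℂ) * Circle.exp (s + u)) ?_ (fun x ↦ ?_) hτ.1.le
    (fun x _ ↦ ofReal_mul_circleExp_mem_ball (by linarith [hτ.2]) (by linarith [hτ.1]) _)
  · simp only [add_zero] at h
    rwa [restrict_Ioo_eq_restrict_Icc]
  · simp only [Circle.coe_exp]
    refine contDiff_const.mul (ContDiff.cexp (ContDiff.mul ?_ contDiff_const))
    exact Complex.ofRealCLM.contDiff.comp (contDiff_const.add contDiff_id)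
  · rw [(hd x).deriv, norm_mul, norm_mul, Circle.norm_coe, Complex.norm_I, Complex.norm_real,
      Real.norm_eq_abs, abs_of_nonneg (by linarith [hτ.2])]
    linarith [hτ.1]

/-- The size of the differential at distance `ρ` from the boundary of the disk. -/
noncomputable def polarGradient (F : ℂ → ℂ) (s ρ : ℝ) : ENNReal :=
  ‖fderiv ℝ F ((1 - ρ : ℝ) * Circle.exp s)‖ₑ

theorem measurable_polarGradient (F : ℂ → ℂ) :
    Measurable (Function.uncurry (polarGradient F)) :=
  ((measurable_fderiv ℝ F).comp (f := fun q : ℝ × ℝ ↦ ((1 - q.2 : ℝ) : ℂ) * Circle.exp q.1)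
    (Continuous.measurable (by fun_prop))).enorm

theorem polarGradient_periodic (F : ℂ → ℂ) (ρ : ℝ) :
    Function.Periodic (fun s ↦ polarGradient F s ρ) (2 * Real.pi) := fun s ↦ by
  simp only [polarGradient, Circle.periodic_exp s]

/-- The path goes in from `e^{is}` to depth `τ`, along the arc at that depth, and out to
`e^{i(s+τ)}`. On the radial legs `y < τ`, so `τ⁻¹` equals the Hardy–Hilbert kernel. -/
theorem enorm_boundary_sub_le {F : ℂ → ℂ} (hF : ContDiffOn ℝ 1 F (ball 0 1))
    (hFc : ContinuousOn F (closedBall 0 1)) {τ : ℝ} (hτ : τ ∈ Ioo (0 : ℝ) (1 / 2)) (s : ℝ) :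
    ‖F (Circle.exp s) - F (Circle.exp (s + τ))‖ₑ * ENNReal.ofReal τ⁻¹ ≤
      (∫⁻ y in Ioo 0 (1 / 2), ENNReal.ofReal (max τ y)⁻¹ * polarGradient F s y) +
      ((∫⁻ y in Ioo 0 (1 / 2), ENNReal.ofReal (max τ y)⁻¹ * polarGradient F (s + τ) y) +
        ENNReal.ofReal τ⁻¹ * ∫⁻ u in Ioo 0 τ, polarGradient F (s + u) τ) := by
  have hτ1 : τ ∈ Ioo (0 : ℝ) 1 := ⟨hτ.1, by linarith [hτ.2]⟩
  have hrad (s : ℝ) : (∫⁻ ρ in Ioo 0 τ, polarGradient F s ρ) * ENNReal.ofReal τ⁻¹ ≤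
      ∫⁻ y in Ioo 0 (1 / 2), ENNReal.ofReal (max τ y)⁻¹ * polarGradient F s y := by
    rw [mul_comm, ← lintegral_const_mul' _ _ ENNReal.ofReal_ne_top]
    calc _ = ∫⁻ y in Ioo 0 τ, ENNReal.ofReal (max τ y)⁻¹ * polarGradient F s y :=
          setLIntegral_congr_fun measurableSet_Ioo fun y hy ↦ by simp only [max_eq_left hy.2.le]
      _ ≤ _ := lintegral_mono_set (Ioo_subset_Ioo_right hτ.2.le)
  have h1 := enorm_sub_le_lintegral_radial hF hFc hτ1 s
  have h2 := enorm_sub_le_lintegral_radial hF hFc hτ1 (s + τ)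
  have h3 := enorm_sub_le_lintegral_arc hF hτ1 s
  have htri : ‖F (Circle.exp s) - F (Circle.exp (s + τ))‖ₑ ≤
      (∫⁻ ρ in Ioo 0 τ, polarGradient F s ρ) + ((∫⁻ ρ in Ioo 0 τ, polarGradient F (s + τ) ρ) +
        ∫⁻ u in Ioo 0 τ, polarGradient F (s + u) τ) := by
    rw [enorm_sub_rev] at h1 h3
    calc _ = ‖(F (Circle.exp s) - F ((1 - τ : ℝ) * Circle.exp s)) +
          ((F ((1 - τ : ℝ) * Circle.exp (s + τ)) - F (Circle.exp (s + τ))) +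
          (F ((1 - τ : ℝ) * Circle.exp s) - F ((1 - τ : ℝ) * Circle.exp (s + τ))))‖ₑ := by
          congr 1; ring
      _ ≤ _ := (enorm_add_le _ _).trans
          (add_le_add h1 ((enorm_add_le _ _).trans (add_le_add h2 h3)))
  calc _ ≤ _ := mul_le_mul_left htri _
    _ = _ := by rw [add_mul, add_mul]
    _ ≤ _ := add_le_add (hrad s) (add_le_add (hrad (s + τ)) (le_of_eq (mul_comm _ _)))

/-- Jensen for the mean over an arc of length `τ`, then Tonelli and rotation invariance. -/
theorem lintegral_arc_rpow_le {F : ℂ → ℂ} {p : ℝ} (hp : 1 < p) {τ : ℝ} (hτ : 0 < τ) :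
    ∫⁻ s in Ioc 0 (2 * Real.pi),
      (ENNReal.ofReal τ⁻¹ * ∫⁻ u in Ioo 0 τ, polarGradient F (s + u) τ) ^ p ≤
    ∫⁻ s in Ioc 0 (2 * Real.pi), polarGradient F s τ ^ p := by
  have hG := measurable_polarGradient F
  have hGs : Measurable fun s ↦ polarGradient F s τ := hG.of_uncurry_right
  have hp0 : 0 ≤ p := by linarith
  have hτt : ENNReal.ofReal τ ≠ ⊤ := ENNReal.ofReal_ne_top
  have hτ0 : ENNReal.ofReal τ ≠ 0 := by simpa using hτ
  have step (s : ℝ) : (ENNReal.ofReal τ⁻¹ * ∫⁻ u in Ioo 0 τ, polarGradient F (s + u) τ) ^ p ≤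
      ENNReal.ofReal τ⁻¹ * ∫⁻ u in Ioo 0 τ, polarGradient F (s + u) τ ^ p := by
    have h := lintegral_rpow_le_measure_univ_mul (μ := volume.restrict (Ioo 0 τ)) hp
      (g := fun u ↦ polarGradient F (s + u) τ) (hGs.comp (by fun_prop))
    rw [Measure.restrict_apply_univ, Real.volume_Ioo, sub_zero] at h
    rw [ENNReal.mul_rpow_of_nonneg _ _ hp0, ENNReal.ofReal_inv_of_pos hτ]
    calc _ ≤ (ENNReal.ofReal τ)⁻¹ ^ p * (ENNReal.ofReal τ ^ (p - 1) *
          ∫⁻ u in Ioo 0 τ, polarGradient F (s + u) τ ^ p) := by gcongr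
      _ = _ := by
          rw [← mul_assoc, ENNReal.inv_rpow, ← ENNReal.rpow_neg, ← ENNReal.rpow_add _ _ hτ0 hτt,
            ← ENNReal.rpow_neg_one]
          congr 2; ring
  calc _ ≤ ∫⁻ s in Ioc 0 (2 * Real.pi),
          ENNReal.ofReal τ⁻¹ * ∫⁻ u in Ioo 0 τ, polarGradient F (s + u) τ ^ p :=
        lintegral_mono step
    _ = ENNReal.ofReal τ⁻¹ * ∫⁻ u in Ioo 0 τ, ∫⁻ s in Ioc 0 (2 * Real.pi),
          polarGradient F (s + u) τ ^ p := by
        rw [lintegral_const_mul' _ _ ENNReal.ofReal_ne_top, lintegral_lintegral_swap]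
        exact ((hGs.comp (measurable_fst.add measurable_snd)).pow_const p).aemeasurable
    _ = ENNReal.ofReal τ⁻¹ * ∫⁻ u in Ioo 0 τ, ∫⁻ s in Ioc 0 (2 * Real.pi),
          polarGradient F s τ ^ p := by
        congr 1
        refine lintegral_congr fun u ↦ ?_
        have h := setLIntegral_Ioc_comp_add_of_periodic (T := 2 * Real.pi) (by positivity)
          (g := fun s ↦ polarGradient F s τ ^ p)
          (fun s ↦ by simp only [polarGradient_periodic F τ s]) 0 0 u
        rwa [zero_add] at h
    _ = _ := by
        rw [lintegral_const, Measure.restrict_apply_univ, Real.volume_Ioo, sub_zero,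
          mul_comm (lintegral _ _), ← mul_assoc, ENNReal.ofReal_inv_of_pos hτ,
          ENNReal.inv_mul_cancel hτ0 hτt, one_mul]

theorem lintegral_arcEnergy_Ioo_half_le {φ : Circle → Circle} (hφ : Continuous φ) {p : ℝ}
    (hp : 1 < p) : ∃ C : ENNReal, C ≠ ⊤ ∧ ∫⁻ τ in Ioo 0 (1 / 2), arcEnergy p φ τ ≤
      C * ∫⁻ τ in Ioo 0 (1 / 2), ∫⁻ s in Ioc 0 (2 * Real.pi),
        polarGradient (harmonicExtension φ) s τ ^ p := by
  obtain ⟨C, hC, hardy⟩ := exists_lintegral_Ioo_inv_max_le hp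
  have hp0 : 0 ≤ p := by linarith
  set F := harmonicExtension φ
  have hF : ContDiffOn ℝ 1 F (ball 0 1) := contDiffOn_harmonicExtension hφ
  have hFc : ContinuousOn F (closedBall 0 1) :=
    (harmonicContOnCl_harmonicExtension hφ).continuousOn_ball
  have hG := measurable_polarGradient F
  set K : ENNReal := ENNReal.ofReal (Real.pi / 2) ^ p * (2 ^ (p - 1)) ^ 2 with hKdef
  have hK : K ≠ ⊤ := ENNReal.mul_ne_top
    (ENNReal.rpow_ne_top_of_nonneg hp0 ENNReal.ofReal_ne_top)
    (ENNReal.pow_ne_top (ENNReal.rpow_ne_top_of_nonneg (by linarith) (by simp)))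
  have hFφ (t : ℝ) : F (Circle.exp t) = φ (Circle.exp t) := harmonicExtension_coe φ _
  let X : ℝ → ℝ → ENNReal := fun s τ ↦
    (∫⁻ y in Ioo 0 (1 / 2), ENNReal.ofReal (max τ y)⁻¹ * polarGradient F s y) ^ p
  have hX : Measurable (Function.uncurry X) := by
    refine Measurable.pow_const (Measurable.lintegral_prod_right' (f := fun y : (ℝ × ℝ) × ℝ ↦
      ENNReal.ofReal (max y.1.2 y.2)⁻¹ * Function.uncurry (polarGradient F) (y.1.1, y.2)) ?_) p
    exact Measurable.mul (by fun_prop) (hG.comp (by fun_prop))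
  have hXper (τ : ℝ) : Function.Periodic (fun s ↦ X s τ) (2 * Real.pi) := fun s ↦ by
    simp only [X, polarGradient_periodic F _ s]
  let M : ℝ → ENNReal := fun τ ↦ ∫⁻ s in Ioc 0 (2 * Real.pi), polarGradient F s τ ^ p
  have step (τ : ℝ) (hτ : τ ∈ Ioo (0 : ℝ) (1 / 2)) : arcEnergy p φ τ ≤
      K * (2 * (∫⁻ s in Ioc 0 (2 * Real.pi), X s τ) + M τ) := by
    have hτ0 : τ ≠ 0 := hτ.1.ne'
    have hτabs : |τ| = τ := abs_of_pos hτ.1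
    have hXτ : Measurable fun s ↦ X s τ := hX.of_uncurry_right
    have hXτ' : Measurable fun s ↦ X (s + τ) τ :=
      hXτ.comp (by fun_prop : Measurable fun s : ℝ ↦ s + τ)
    have hshift : ∫⁻ s in Ioc 0 (2 * Real.pi), X (s + τ) τ =
        ∫⁻ s in Ioc 0 (2 * Real.pi), X s τ := by
      have h := setLIntegral_Ioc_comp_add_of_periodic (T := 2 * Real.pi) (by positivity)
        (hXper τ) 0 0 τ
      rwa [zero_add] at h
    calc arcEnergy p φ τ ≤ ∫⁻ s in Ioc 0 (2 * Real.pi), K * (X s τ + (X (s + τ) τ +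
          (ENNReal.ofReal τ⁻¹ * ∫⁻ u in Ioo 0 τ, polarGradient F (s + u) τ) ^ p)) := by
          refine lintegral_mono fun s ↦ ?_
          have h1 := enorm_div_le_mul_inv hτ0
            (by rw [hτabs]; linarith [hτ.2, Real.pi_gt_three]) s
            ((φ (Circle.exp s) : ℂ) - φ (Circle.exp (s + τ)))
          have h2 := enorm_boundary_sub_le hF hFc hτ s
          rw [hFφ, hFφ] at h2
          rw [hτabs] at h1
          rw [hKdef, mul_assoc]
          refine (ENNReal.rpow_le_rpow h1 hp0).trans ?_
          rw [ENNReal.mul_rpow_of_nonneg _ _ hp0]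
          gcongr
          exact (ENNReal.rpow_le_rpow h2 hp0).trans (rpow_add_add_le hp.le _ _ _)
      _ = K * ((∫⁻ s in Ioc 0 (2 * Real.pi), X s τ) + ((∫⁻ s in Ioc 0 (2 * Real.pi), X s τ) +
          ∫⁻ s in Ioc 0 (2 * Real.pi),
          (ENNReal.ofReal τ⁻¹ * ∫⁻ u in Ioo 0 τ, polarGradient F (s + u) τ) ^ p)) := by
          rw [lintegral_const_mul' _ _ hK, lintegral_add_left hXτ,
            lintegral_add_left hXτ', hshift]
      _ ≤ K * ((∫⁻ s in Ioc 0 (2 * Real.pi), X s τ) +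
          ((∫⁻ s in Ioc 0 (2 * Real.pi), X s τ) + M τ)) := by
          gcongr
          exact lintegral_arc_rpow_le hp hτ.1
      _ = _ := by rw [← add_assoc, ← two_mul]
  have hXint : ∫⁻ τ in Ioo 0 (1 / 2), ∫⁻ s in Ioc 0 (2 * Real.pi), X s τ ≤
      C * ∫⁻ τ in Ioo 0 (1 / 2), M τ := by
    rw [lintegral_lintegral_swap (f := fun τ s ↦ X s τ)
      (hX.comp measurable_swap).aemeasurable]
    calc _ ≤ ∫⁻ s in Ioc 0 (2 * Real.pi), C * ∫⁻ y in Ioo 0 (1 / 2), polarGradient F s y ^ p := by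
          refine lintegral_mono fun s ↦ ?_
          exact (lintegral_mono_set (fun x hx ↦ hx.1)).trans (hardy _ _ hG.of_uncurry_left)
      _ = _ := by
          rw [lintegral_const_mul' _ _ hC, lintegral_lintegral_swap]
          exact (hG.pow_const p).aemeasurable
  refine ⟨K * (2 * C + 1), ENNReal.mul_ne_top hK (by finiteness), ?_⟩
  calc _ ≤ ∫⁻ τ in Ioo 0 (1 / 2), K * (2 * (∫⁻ s in Ioc 0 (2 * Real.pi), X s τ) + M τ) :=
        setLIntegral_mono' measurableSet_Ioo step
    _ = K * (2 * (∫⁻ τ in Ioo 0 (1 / 2), ∫⁻ s in Ioc 0 (2 * Real.pi), X s τ) +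
          ∫⁻ τ in Ioo 0 (1 / 2), M τ) := by
        rw [lintegral_const_mul' _ _ hK, lintegral_add_left, lintegral_const_mul' _ _ (by simp)]
        exact (hX.lintegral_prod_left').const_mul 2
    _ ≤ K * (2 * (C * ∫⁻ τ in Ioo 0 (1 / 2), M τ) + ∫⁻ τ in Ioo 0 (1 / 2), M τ) := by gcongr
    _ = _ := by ring

/-- Long arcs are harmless: `φ` has unit modulus and the chord is bounded below. The factors `2 * 2`
bound the numerator and `τ⁻¹`. -/
theorem arcEnergy_le_of_half_le {φ : Circle → Circle} {p : ℝ} (hp : 0 ≤ p) {τ : ℝ}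
    (hτ : τ ∈ Ico (1 / 2) Real.pi) :
    arcEnergy p φ τ ≤ (ENNReal.ofReal (Real.pi / 2) * (2 * 2)) ^ p *
      ENNReal.ofReal (2 * Real.pi) := by
  have hτ0 : 0 < τ := by linarith [hτ.1]
  calc _ ≤ ∫⁻ _ in Ioc 0 (2 * Real.pi), (ENNReal.ofReal (Real.pi / 2) * (2 * 2)) ^ p := by
        refine lintegral_mono fun s ↦ ENNReal.rpow_le_rpow ?_ hp
        refine (enorm_div_le_mul_inv hτ0.ne' (by rw [abs_of_pos hτ0]; exact hτ.2.le) s _).trans ?_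
        gcongr
        · refine (enorm_sub_le).trans (le_of_eq ?_)
          rw [← ofReal_norm, ← ofReal_norm, Circle.norm_coe, Circle.norm_coe]
          simpa using one_add_one_eq_two
        · rw [abs_of_pos hτ0]
          calc ENNReal.ofReal τ⁻¹ ≤ ENNReal.ofReal 2 := by
                refine ENNReal.ofReal_le_ofReal ?_
                rw [inv_le_comm₀ hτ0 two_pos]
                linarith [hτ.1]
            _ = 2 := by simp
    _ = _ := by
        rw [lintegral_const, Measure.restrict_apply_univ, Real.volume_Ioc, sub_zero]

theorem lintegral_arcEnergy_lt_top {φ : Circle → Circle} (hφ : Continuous φ) {p : ℝ}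
    (hp : 1 < p) (h : ∫⁻ z in ball (0 : ℂ) 1, ‖fderiv ℝ (harmonicExtension φ) z‖ₑ ^ p < ⊤) :
    ∫⁻ τ in Ioo 0 Real.pi, arcEnergy p φ τ < ⊤ := by
  obtain ⟨C, hC, hle⟩ := lintegral_arcEnergy_Ioo_half_le hφ hp
  have hp0 : 0 ≤ p := by linarith
  rw [← Ioo_union_Ico_eq_Ioo (show (0 : ℝ) < 1 / 2 by norm_num)
    (show 1 / 2 ≤ Real.pi by linarith [Real.pi_gt_three])]
  refine (lintegral_union_le _ _ _).trans_lt (ENNReal.add_lt_top.2 ⟨hle.trans_lt ?_, ?_⟩)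
  · refine ENNReal.mul_lt_top hC.lt_top ?_
    rw [lintegral_ball_eq_polar (measurable_norm_fderiv_rpow _ p)] at h
    -- At depth below `1 / 2` the polar Jacobian `1 - τ` is at least `1 / 2`.
    have h2 : ENNReal.ofReal (1 / 2) * ∫⁻ τ in Ioo 0 (1 / 2), ∫⁻ s in Ioc 0 (2 * Real.pi),
        polarGradient (harmonicExtension φ) s τ ^ p < ⊤ := by
      refine lt_of_le_of_lt ?_ h
      rw [← lintegral_const_mul' _ _ ENNReal.ofReal_ne_top]
      refine le_trans ?_ (lintegral_mono_set (show Ioo (0 : ℝ) (1 / 2) ⊆ Ioo 0 1 from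
        Ioo_subset_Ioo_right (by norm_num)))
      refine setLIntegral_mono' measurableSet_Ioo fun τ hτ ↦ ?_
      refine mul_le_mul' (ENNReal.ofReal_le_ofReal (by linarith [hτ.2])) le_rfl
    rw [ENNReal.mul_lt_top_iff] at h2
    rcases h2 with h2 | h2 | h2
    · exact h2.2
    · norm_num at h2
    · rw [h2]; exact ENNReal.zero_lt_top
  · refine (setLIntegral_mono' measurableSet_Ico
      fun τ hτ ↦ arcEnergy_le_of_half_le hp0 hτ).trans_lt ?_
    rw [lintegral_const, Measure.restrict_apply_univ, Real.volume_Ico]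
    have : (ENNReal.ofReal (Real.pi / 2) * (2 * 2)) ^ p ≠ ⊤ :=
      ENNReal.rpow_ne_top_of_nonneg hp0 (by finiteness)
    finiteness

theorem theorem1p1 (φ : Circle ≃ₜ Circle) :
    InnerProductSpace.HarmonicOnNhd (harmonicExtension φ) (Metric.ball (0 : ℂ) 1) ∧
    (∃ H : Metric.closedBall (0 : ℂ) 1 ≃ₜ Metric.closedBall (0 : ℂ) 1,
      ∀ z : Metric.closedBall (0 : ℂ) 1, (H z : ℂ) = harmonicExtension φ z) ∧
    (∀ ξ : Circle, harmonicExtension φ ξ = φ ξ) ∧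
    ∀ p : ℝ, 1 < p →
      (MemW1p (ENNReal.ofReal p) (harmonicExtension φ) (Metric.ball (0 : ℂ) 1) ↔
        DouglasCondition p φ) := by
  refine ⟨harmonicOnNhd_harmonicExtension φ.continuous, exists_homeomorph_harmonicExtension φ,
    harmonicExtension_coe φ, fun p hp ↦ ?_⟩
  rw [memW1p_harmonicExtension_iff φ hp, douglasCondition_iff φ.continuous p (by linarith)]
  exact ⟨lintegral_arcEnergy_lt_top φ.continuous hp,
    lintegral_fderiv_lt_top_of_arcEnergy φ.continuous hp⟩
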